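/- Let $\mathcal S$ be the real vector space of smooth functions $\varphi:(0,\pi)\times\mathbb S^2\to\mathbb R$ that are invariant under the rotations about the polar axis and satisfy $$\ddot\varphi+\cot t\,\dot\varphi-\Delta_{\mathbb S^2}\varphi=0 ,$$ where $\Delta_{\mathbb S^2}$ is the Laplacian of the round unit sphere. (This is the equation of each original scalar field $\phi$ of the deparameterized $\mathbb S^1\times\mathbb S^2$ and $\mathbb S^3$ Gowdy models.) For $t_0,t_1\in(0,\pi)$ the classical time evolution $\mathcal T_{(t_1,t_0)}:\mathcal S\to\mathcal S$ sends $\varphi$ to the solution whose Cauchy data $(Q,P)=(\varphi,\sin t\,\dot\varphi)$ at time $t_0$ are those of $\varphi$ at time $t_1$. Let $P_\ell$, $Q_\ell$ be the Legendre functions of the first and second kind on $(-1,1)$, and let $Y_{\ell0}(s)=\sqrt{(2\ell+1)/4\pi}\,P_\ell(\cos\theta(s))$. The $SO(3)$-invariant complex structures are parameterized by pairs of sequences $\rho_\ell>0$, $\nu_\ell\in\mathbb R$ ($\ell\in\mathbb N_0$): put $$y_\ell(t)=\tfrac1{\sqrt2}\Big(\rho_\ell P_\ell(\cos t)+(\nu_\ell+i\rho_\ell^{-1})\,Q_\ell(\cos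 t)\Big),$$ and let $y_\ell Y_{\ell0}$ and $\bar y_\ell Y_{\ell 0}$ be eigenvectors of $J$ for the eigenvalues $i$ and $-i$. The one-particle Hilbert space is the space $\ell^2(\mathbb N_0,\mathbb C)$ with orthonormal basis $(y_\ell Y_{\ell0})_\ell$. A solution $\varphi=\sum_\ell(a_\ell y_\ell+\overline{a_\ell y_\ell})Y_{\ell0}$ with $\sum_\ell|a_\ell|^2<\infty$ has the one-particle vector $\kappa(\varphi)=(a_\ell)_\ell$. On the symmetric Fock space $\mathscr F$ over $\ell^2(\mathbb N_0,\mathbb C)$, with annihilation and creation operators $A(f)$, $C(f)$, let $\pi(W(\varphi))=\exp\big(i\,\hat\Omega(\varphi)\big)$, where $\hat\Omega(\varphi)$ is the self-adjoint closure of $i\big(A(\kappa(\varphi))-C(\kappa(\varphi))\big)$ on the vectors with finitely many particles. The map $\mathcal T_{(t_1,t_0)}$ is called unitarily implementable on $\mathscr F$ if there is a unitary operator $U$ on $\mathscr F$ with $U^{-1}\pi(W(\varphi))\,U=\pi\big(W(\mathcal T_{(t_1,t_0)}\varphi)\big)$ for all $\varphi\in\mathcal S$ such that $\varphi$ and $\mathcal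 T_{(t_1,t_0)}\varphi$ have one-particle vectors in $\ell^2$. Finally let $$\beta_\ell(t_1,t_0)=i\big(\sin t_1\,\bar y_\ell(t_0)\,\dot{\bar y}_\ell(t_1)-\sin t_0\,\bar y_\ell(t_1)\,\dot{\bar y}_\ell(t_0)\big).$$ Then for all sequences $(\rho_\ell)$, $(\nu_\ell)$ with $\rho_\ell>0$ and $\nu_\ell\in\mathbb R$, for every $t_0\in(0,\pi)$ and for almost every $t_1\in(0,\pi)$: $$\sum_{\ell=0}^\infty\big(\operatorname{Re}\beta_\ell(t_1,t_0)\big)^2=\infty ,$$ and $\mathcal T_{(t_1,t_0)}$ is not unitarily implementable on $\mathscr F$. In particular, for no choice of $(\rho_\ell,\nu_\ell)$ is $\mathcal T_{(t_1,t_0)}$ unitarily implementable for all $t_0,t_1\in(0,\pi)$. -/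

import Mathlib

open Real Set MeasureTheory
open scoped Manifold ContDiff ComplexConjugate

noncomputable section

namespace Gowdy

/-! ### Legendre functions of the first and second kind on `(-1, 1)` -/

/-- The solution of Bonnet's three-term recurrence
`(n + 2) X (n + 2) = (2 n + 3) x X (n + 1) - (n + 1) X n` with `X 0 = a` and `X 1 = b`. -/
def bonnet (x a b : ℝ) : ℕ → ℝ
  | 0 => a
  | 1 => b
  | n + 2 => ((2 * (n : ℝ) + 3) * x * bonnet x a b (n + 1) - ((n : ℝ) + 1) * bonnet x a b n)
      / ((n : ℝ) + 2)

/-- The Legendre polynomial `P_ℓ`: `P_0 = 1`, `P_1 = x`. -/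
def legendreP (l : ℕ) (x : ℝ) : ℝ := bonnet x 1 x l

/-- The Legendre function of the second kind `Q_ℓ` on the cut `(-1, 1)`:
`Q_0 = (1/2) log ((1 + x) / (1 - x))`, `Q_1 = x Q_0 - 1`. -/
def legendreQ (l : ℕ) (x : ℝ) : ℝ :=
  bonnet x (1 / 2 * Real.log ((1 + x) / (1 - x)))
    (x * (1 / 2 * Real.log ((1 + x) / (1 - x))) - 1) l

/-! ### Mode functions -/

/-- `u_{0ℓ}(t) = P_ℓ(cos t) / √2`. -/
def u0 (l : ℕ) (t : ℝ) : ℝ := 1 / √2 * legendreP l (Real.cos t)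

/-- `v_{0ℓ}(t) = Q_ℓ(cos t) / √2`. -/
def v0 (l : ℕ) (t : ℝ) : ℝ := 1 / √2 * legendreQ l (Real.cos t)

/-- `y_ℓ = ρ_ℓ u_{0ℓ} + (ν_ℓ + i ρ_ℓ⁻¹) v_{0ℓ}`. The functions `y_ℓ Y_{ℓ0}` span the
`i`-eigenspace of the `SO(3)`-invariant complex structure with parameters `(ρ_ℓ, ν_ℓ)`. -/
def modeFun (ρ ν : ℕ → ℝ) (l : ℕ) (t : ℝ) : ℂ :=
  (ρ l : ℂ) * (u0 l t : ℂ) + ((ν l : ℂ) + Complex.I * ((ρ l)⁻¹ : ℝ)) * (v0 l t : ℂ)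

/-- `β_ℓ(t₁, t₀ | y_ℓ) = i (sin t₁ ȳ_ℓ(t₀) ẏ̄_ℓ(t₁) - sin t₀ ȳ_ℓ(t₁) ẏ̄_ℓ(t₀))`. -/
def beta (y : ℕ → ℝ → ℂ) (t₁ t₀ : ℝ) (l : ℕ) : ℂ :=
  Complex.I * ((Real.sin t₁ : ℂ) * conj (y l t₀) * conj (deriv (y l) t₁)
    - (Real.sin t₀ : ℂ) * conj (y l t₁) * conj (deriv (y l) t₀))

/-! ### The classical field -/

/-- Euclidean three-space. -/
abbrev E3 : Type := EuclideanSpace ℝ (Fin (2 + 1))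

/-- The unit two-sphere. -/
abbrev S2 : Type := Metric.sphere (0 : E3) 1

/-- The extension of `f : S2 → ℝ` to `E3 \ {0}` that is constant along rays. -/
def radialExtension (f : S2 → ℝ) (x : E3) : ℝ :=
  if hx : x ≠ 0 then f ⟨‖x‖⁻¹ • x, by simp [norm_smul, hx]⟩ else 0

/-- The Laplace-Beltrami operator of the round unit two-sphere: on the unit sphere it is the
Euclidean Laplacian of the extension that is constant along rays. -/
def sphereLaplacian (f : S2 → ℝ) (s : S2) : ℝ :=
  Laplacian.laplacian (radialExtension f) (s : E3)

/-- The height (third Cartesian coordinate, `cos θ`) of a point of the two-sphere. -/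
def height (s : S2) : ℝ := (s : E3) 2

/-- The axially symmetric spherical harmonic `Y_{ℓ0}`. -/
def sphHarm (l : ℕ) (s : S2) : ℝ :=
  √((2 * (l : ℝ) + 1) / (4 * π)) * legendreP l (height s)

/-- The solution space: smooth, real, axially symmetric solutions on `(0, π) × S2` of
`φ̈ + cot t φ̇ - Δ φ = 0`. Two points of the sphere lie on the same orbit of the rotations about
the axis iff they have the same height. Values at times outside `(0, π)` play no role. -/
structure IsSolution (φ : ℝ → S2 → ℝ) : Prop where
  smooth : ContMDiffOn (𝓘(ℝ, ℝ).prod (𝓡 2)) 𝓘(ℝ, ℝ) ∞ (fun p : ℝ × S2 => φ p.1 p.2)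
    (Ioo 0 π ×ˢ univ)
  field_eq : ∀ t ∈ Ioo 0 π, ∀ s : S2,
    deriv (deriv fun τ => φ τ s) t + Real.cot t * deriv (fun τ => φ τ s) t
      - sphereLaplacian (φ t) s = 0
  axial : ∀ t ∈ Ioo 0 π, ∀ s s' : S2, height s = height s' → φ t s = φ t s'

/-- `Evolves t₁ t₀ φ ψ` says `ψ = T_(t₁,t₀) φ` for solutions `φ`, `ψ`: the Cauchy data
`(Q, P) = (φ, sin t φ̇)` that `φ` induces at time `t₁` are those that `ψ` induces at time `t₀`. -/
def Evolves (t₁ t₀ : ℝ) (φ ψ : ℝ → S2 → ℝ) : Prop :=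
  ∀ s : S2, ψ t₀ s = φ t₁ s ∧
    Real.sin t₀ * deriv (fun τ => ψ τ s) t₀ = Real.sin t₁ * deriv (fun τ => φ τ s) t₁

/-! ### Fock space -/

/-- The one-particle Hilbert space: `a` stands for `∑ a_ℓ y_ℓ Y_{ℓ0}`, and the
`y_ℓ Y_{ℓ0}` form an orthonormal basis. -/
abbrev OneParticle : Type := lp (fun _ : ℕ => ℂ) 2

/-- `a` is the one-particle vector of the solution `φ`:
`φ(t, s) = ∑ (a_ℓ y_ℓ(t) + c.c.) Y_{ℓ0}(s)`. -/
def IsOneParticleVector (y : ℕ → ℝ → ℂ) (φ : ℝ → S2 → ℝ) (a : OneParticle) : Prop :=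
  ∀ t ∈ Ioo 0 π, ∀ s : S2,
    HasSum (fun l : ℕ => (a l * y l t + (starRingEnd ℂ) (a l * y l t)) * (sphHarm l s : ℂ)) (φ t s : ℂ)

/-- The symmetric Fock space over `OneParticle`, in the occupation number representation: the
orthonormal basis vectors `|n⟩` are labelled by the finitely supported `n : ℕ → ℕ`. -/
abbrev Fock : Type := lp (fun _ : ℕ →₀ ℕ => ℂ) 2

/-- The creation operator `C(f) = ∑ f_ℓ a_ℓ†`, where `a_ℓ† |n⟩ = √(n_ℓ + 1) |n + 1_ℓ⟩`, on
coefficient functions. -/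
def creation (f : OneParticle) (Ψ : (ℕ →₀ ℕ) → ℂ) (n : ℕ →₀ ℕ) : ℂ :=
  ∑ l ∈ n.support, f l * (√(n l : ℝ) : ℂ) * Ψ (n - Finsupp.single l 1)

/-- The annihilation operator `A(f) = ∑ f̄_ℓ a_ℓ`, where `a_ℓ |n⟩ = √n_ℓ |n - 1_ℓ⟩`, on
coefficient functions. The series converges absolutely on vectors with finitely many particles. -/
def annihilation (f : OneParticle) (Ψ : (ℕ →₀ ℕ) → ℂ) (n : ℕ →₀ ℕ) : ℂ :=
  ∑' l : ℕ, (starRingEnd ℂ) (f l) * (√((n l : ℝ) + 1) : ℂ) * Ψ (n + Finsupp.single l 1)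

/-- The fundamental observable `i (A(f) - C(f))`. -/
def fieldOperator (f : OneParticle) (Ψ : (ℕ →₀ ℕ) → ℂ) : (ℕ →₀ ℕ) → ℂ :=
  fun n => Complex.I * (annihilation f Ψ n - creation f Ψ n)

/-- A Fock vector with finitely many particles. -/
def IsFiniteParticle (Ψ : Fock) : Prop :=
  ∃ N : ℕ, ∀ n : ℕ →₀ ℕ, N < n.degree → Ψ n = 0

/-- `V` is the Weyl operator `exp (i Ω̂)`, where `Ω̂` is the (self-adjoint closure of the)
fundamental observable of `f`. The vectors with finitely many particles are dense and analytic
for `Ω̂`, so that `V` is the only unitary operator given on them by the exponential series. -/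
def IsWeylOperator (f : OneParticle) (V : Fock ≃ₗᵢ[ℂ] Fock) : Prop :=
  ∀ Ψ : Fock, IsFiniteParticle Ψ → ∀ n : ℕ →₀ ℕ,
    HasSum (fun k : ℕ => Complex.I ^ k / (k.factorial : ℂ) * (fieldOperator f)^[k] (⇑Ψ) n)
      (V Ψ n)

/-- `T_(t₁,t₀)` is unitarily implementable on the Fock space of the complex structure with mode
functions `y`: some unitary `U` satisfies `U⁻¹ π(W(φ)) U = π(W(T_(t₁,t₀) φ))` for all `φ`. -/
def UnitarilyImplementable (y : ℕ → ℝ → ℂ) (t₁ t₀ : ℝ) : Prop :=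
  ∃ U : Fock ≃ₗᵢ[ℂ] Fock,
    ∀ φ ψ : ℝ → S2 → ℝ, IsSolution φ → IsSolution ψ → Evolves t₁ t₀ φ ψ →
    ∀ a b : OneParticle, IsOneParticleVector y φ a → IsOneParticleVector y ψ b →
    ∀ V V' : Fock ≃ₗᵢ[ℂ] Fock, IsWeylOperator a V → IsWeylOperator b V' →
    ∀ Ψ : Fock, U.symm (V (U Ψ)) = V' Ψ

end Gowdy

end

noncomputable section

namespace Gowdy

/-! The proof has two independent halves. One shows that the real parts of the coefficients β do not
even tend to zero; the other shows that a unitary implementation would make the β square summable.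

First half. In Re β the parameters enter only through ν/ρ (`beta_re`). As a function of t₁ it is sin
t₁ h'(t₁) - sin t₀ k(t₁), where h and k solve the mode equation of frequency λ = ℓ + 1/2 with Cauchy
data (H, K) and (K, L) at t₀. The Wronskian gives HL - K² = -1/(4 sin² t₀) whatever ν/ρ is, so the
rescaled triple (λH, K, L/λ) stays away from zero. After multiplication by √sin t, modes are free
oscillations up to a relative error O(1/λ) (`exists_modeSolution_asymptotics`). If Re β tends to
zero at t₁, so does K (sin t₁ - sin t₀) cos λ(t₁ - t₀) - (λH sin t₁ + (L/λ) sin t₀) sin λ(t₁ - t₀),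
even after division by the norm of the triple (`tendsto_oscillation_of_tendsto`). Compactness of the
unit sphere replaces the normalised triples by a fixed limit along a subsequence. By the
Riemann-Lebesgue lemma the limiting amplitudes then vanish at almost every such t₁
(`ae_eq_zero_of_tendsto_oscillation`), which forces the limit to be zero although it has norm one.

Second half. Only solutions with a single mode are needed. Evolution acts on them by z ↦ αz + βz̄
with |α|² - |β|² = 1, and a unit phase z can be chosen for which the image has squared norm at least
1 + 2|β| (`exists_phase`). Vacuum expectations of Weyl operators are exp(-‖z‖²/2), so
implementability compares exp(-1/2) with something smaller by an amount comparable to |β| for small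
β. Fluctuations of Weyl operators of different modes on a number state are mutually orthogonal.
Hence a unitary intertwiner permits only square summable differences of these expectations
(`summable_sq_of_intertwining`), and Σ|β|² is finite. The Weyl operators themselves are built from
the exponential series of a skew operator on finite-particle vectors (`exists_unitary_of_skew`). -/

/-! ### Derivatives of solutions of Bonnet's recurrence -/

/-- The first derivative of `bonnet`, from the value `a'` of the derivative of the seed `a`. -/
def bonnetD (x a b a' : ℝ) : ℕ → ℝ
  | 0 => a'
  | n + 1 => x * bonnetD x a b a' n + ((n : ℝ) + 1) * bonnet x a b n

/-- The second derivative of `bonnet`. -/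
def bonnetDD (x a b a' a'' : ℝ) : ℕ → ℝ
  | 0 => a''
  | n + 1 => x * bonnetDD x a b a' a'' n + ((n : ℝ) + 2) * bonnetD x a b a' n

theorem bonnet_succ_succ (x a b : ℝ) (n : ℕ) :
    ((n : ℝ) + 2) * bonnet x a b (n + 2)
      = (2 * (n : ℝ) + 3) * x * bonnet x a b (n + 1) - ((n : ℝ) + 1) * bonnet x a b n := by
  rw [bonnet]
  field_simp

/-- Second ladder relation, complementing the one that defines `bonnetD`. The hypothesis `h` is its
case n = 0 rearranged, and Bonnet's recurrence propagates it. -/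
theorem mul_bonnetD_succ {x a b a' : ℝ} (h : (x ^ 2 - 1) * a' + x * a = b) (n : ℕ) :
    x * bonnetD x a b a' (n + 1)
      = bonnetD x a b a' n + ((n : ℝ) + 1) * bonnet x a b (n + 1) := by
  induction n with
  | zero =>
    simp only [bonnetD, bonnet, Nat.cast_zero]
    linarith
  | succ n ih =>
    have h1 := bonnet_succ_succ x a b n
    have h2 : bonnetD x a b a' (n + 1 + 1) = x * bonnetD x a b a' (n + 1)
      + (((n + 1 : ℕ) : ℝ) + 1) * bonnet x a b (n + 1) := rfl
    have h3 : bonnetD x a b a' (n + 1) = x * bonnetD x a b a' n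
      + ((n : ℝ) + 1) * bonnet x a b n := rfl
    rw [h2]
    push_cast at *
    linear_combination x * ih - h3 - h1

theorem one_sub_sq_mul_bonnetD {x a b a' : ℝ} (h : (x ^ 2 - 1) * a' + x * a = b) (n : ℕ) :
    (1 - x ^ 2) * bonnetD x a b a' n
      = ((n : ℝ) + 1) * (x * bonnet x a b n - bonnet x a b (n + 1)) := by
  have h1 := mul_bonnetD_succ h n
  simp only [bonnetD] at h1
  linear_combination -h1

theorem bonnetDD_legendre {x a b a' a'' : ℝ} (h : (x ^ 2 - 1) * a' + x * a = b)
    (h' : (1 - x ^ 2) * a'' - 2 * x * a' = 0) (n : ℕ) :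
    (1 - x ^ 2) * bonnetDD x a b a' a'' n - 2 * x * bonnetD x a b a' n
      + (n : ℝ) * ((n : ℝ) + 1) * bonnet x a b n = 0 := by
  induction n with
  | zero => simpa [bonnetD, bonnetDD] using h'
  | succ n ih =>
    have h1 := one_sub_sq_mul_bonnetD h n
    simp only [bonnetD, bonnetDD]
    push_cast
    linear_combination x * ih + ((n : ℝ) + 2) * h1

/-- Differentiating Bonnet's three-term recurrence and using the second ladder relation
`mul_bonnetD_succ` reproduces the one-step recursion of `bonnetD`. -/
theorem bonnet_hasDerivAt {a b : ℝ → ℝ} {x a' : ℝ} (ha : HasDerivAt a a' x)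
    (hb : HasDerivAt b (x * a' + a x) x) (h : (x ^ 2 - 1) * a' + x * a x = b x) (n : ℕ) :
    HasDerivAt (fun y => bonnet y (a y) (b y) n) (bonnetD x (a x) (b x) a' n) x := by
  induction n using Nat.twoStepInduction with
  | zero => simpa [bonnet, bonnetD] using ha
  | one => simpa [bonnet, bonnetD] using hb
  | more n ih0 ih1 =>
    have h1 := mul_bonnetD_succ h n
    have h2 := ((((hasDerivAt_id x).const_mul (2 * (n : ℝ) + 3)).mul ih1).sub
      (ih0.const_mul ((n : ℝ) + 1))).div_const ((n : ℝ) + 2)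
    refine h2.congr_deriv ?_
    have h3 : bonnetD x (a x) (b x) a' (n + 2) = x * bonnetD x (a x) (b x) a' (n + 1)
      + (((n + 1 : ℕ) : ℝ) + 1) * bonnet x (a x) (b x) (n + 1) := rfl
    rw [h3]
    have : (n : ℝ) + 2 ≠ 0 := by positivity
    field_simp
    push_cast
    simp only [id]
    linear_combination ((n : ℝ) + 1) * h1

theorem bonnetD_hasDerivAt {a b a' : ℝ → ℝ} {x a'' : ℝ} (ha : HasDerivAt a (a' x) x)
    (hb : HasDerivAt b (x * a' x + a x) x) (h : (x ^ 2 - 1) * a' x + x * a x = b x)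
    (ha' : HasDerivAt a' a'' x) (n : ℕ) :
    HasDerivAt (fun y => bonnetD y (a y) (b y) (a' y) n)
      (bonnetDD x (a x) (b x) (a' x) a'' n) x := by
  induction n with
  | zero => simpa [bonnetD, bonnetDD] using ha'
  | succ n ih =>
    have h2 := ((hasDerivAt_id x).mul ih).add
      ((bonnet_hasDerivAt ha hb h n).const_mul ((n : ℝ) + 1))
    refine h2.congr_deriv ?_
    simp only [bonnetDD, id]
    ring

/-- Cross-multiplying the two recurrences cancels the middle terms, so n + 1 times the Casoratian is
independent of n. This yields the Wronskian of P and Q algebraically. -/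
theorem bonnet_casoratian (x a b c d : ℝ) (n : ℕ) :
    ((n : ℝ) + 1) * (bonnet x c d n * bonnet x a b (n + 1) - bonnet x a b n * bonnet x c d (n + 1))
      = c * b - a * d := by
  induction n with
  | zero => simp [bonnet]
  | succ n ih =>
    have h1 := bonnet_succ_succ x a b n
    have h2 := bonnet_succ_succ x c d n
    push_cast
    linear_combination ih + bonnet x c d (n + 1) * h1 - bonnet x a b (n + 1) * h2

theorem bonnet_contDiffOn {a b : ℝ → ℝ} {s : Set ℝ} (ha : ContDiffOn ℝ ∞ a s)
    (hb : ContDiffOn ℝ ∞ b s) (n : ℕ) : ContDiffOn ℝ ∞ (fun y => bonnet y (a y) (b y) n) s := by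
  induction n using Nat.twoStepInduction with
  | zero => simpa [bonnet] using ha
  | one => simpa [bonnet] using hb
  | more n ih0 ih1 =>
    simp only [bonnet]
    exact (((contDiffOn_const.mul contDiffOn_id).mul ih1).sub
      (contDiffOn_const.mul ih0)).div_const _

/-! ### Legendre functions -/

/-- `P_ℓ'`. -/
def legendrePD (l : ℕ) (x : ℝ) : ℝ := bonnetD x 1 x 0 l

/-- `P_ℓ''`. -/
def legendrePDD (l : ℕ) (x : ℝ) : ℝ := bonnetDD x 1 x 0 0 l

/-- `Q_0(x) = (1/2) log ((1 + x) / (1 - x))`. -/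
def legendreQZero (x : ℝ) : ℝ := 1 / 2 * Real.log ((1 + x) / (1 - x))

/-- `Q_ℓ'`. -/
def legendreQD (l : ℕ) (x : ℝ) : ℝ :=
  bonnetD x (legendreQZero x) (x * legendreQZero x - 1) (1 - x ^ 2)⁻¹ l

/-- `Q_ℓ''`. -/
def legendreQDD (l : ℕ) (x : ℝ) : ℝ :=
  bonnetDD x (legendreQZero x) (x * legendreQZero x - 1) (1 - x ^ 2)⁻¹
    (2 * x * ((1 - x ^ 2) ^ 2)⁻¹) l

theorem legendreP_hasDerivAt (l : ℕ) (x : ℝ) : HasDerivAt (legendreP l) (legendrePD l x) x :=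
  bonnet_hasDerivAt (a := fun _ => 1) (b := fun y => y) (hasDerivAt_const x 1)
    (by simpa using hasDerivAt_id' x) (by simp) l

theorem legendrePD_hasDerivAt (l : ℕ) (x : ℝ) : HasDerivAt (legendrePD l) (legendrePDD l x) x :=
  bonnetD_hasDerivAt (a := fun _ => 1) (b := fun y => y) (a' := fun _ => 0) (hasDerivAt_const x 1)
    (by simpa using hasDerivAt_id' x) (by simp) (hasDerivAt_const x 0) l

theorem legendreP_ode (l : ℕ) (x : ℝ) :
    (1 - x ^ 2) * legendrePDD l x - 2 * x * legendrePD l x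
      + (l : ℝ) * ((l : ℝ) + 1) * legendreP l x = 0 :=
  bonnetDD_legendre (by ring) (by ring) l

theorem legendreP_contDiff (l : ℕ) : ContDiff ℝ ∞ (legendreP l) := by
  rw [← contDiffOn_univ]
  exact bonnet_contDiffOn (a := fun _ => 1) (b := fun y => y) contDiffOn_const contDiffOn_id l

theorem one_sub_sq_pos {x : ℝ} (hx : x ∈ Ioo (-1 : ℝ) 1) : 0 < 1 - x ^ 2 := by
  nlinarith [mul_pos (sub_pos.2 hx.1) (sub_pos.2 hx.2)]

theorem legendreQZero_hasDerivAt {x : ℝ} (hx : x ∈ Ioo (-1 : ℝ) 1) :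
    HasDerivAt legendreQZero (1 - x ^ 2)⁻¹ x := by
  have h1 : 0 < 1 + x := by linarith [hx.1]
  have h2 : 0 < 1 - x := by linarith [hx.2]
  have h3 := ((((hasDerivAt_id x).const_add 1).div ((hasDerivAt_id x).const_sub 1)
    (by simpa using h2.ne')).log (by simpa using ⟨h1.ne', h2.ne'⟩)).const_mul (1 / 2)
  refine h3.congr_deriv ?_
  have : (1 : ℝ) - x ^ 2 ≠ 0 := (one_sub_sq_pos hx).ne'
  simp only [id, Pi.div_apply]
  field_simp
  ring

theorem legendreQZero_contDiffOn : ContDiffOn ℝ ∞ legendreQZero (Ioo (-1) 1) := by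
  intro x hx
  have h1 : 0 < 1 + x := by linarith [hx.1]
  have h2 : 0 < 1 - x := by linarith [hx.2]
  refine ContDiffAt.contDiffWithinAt ?_
  exact contDiffAt_const.mul (((contDiffAt_const.add contDiffAt_id).div
    (contDiffAt_const.sub contDiffAt_id) (by simpa using h2.ne')).log
      (div_pos h1 h2).ne')

theorem legendreQ_seed {x : ℝ} (hx : x ∈ Ioo (-1 : ℝ) 1) :
    (x ^ 2 - 1) * (1 - x ^ 2)⁻¹ + x * legendreQZero x = x * legendreQZero x - 1 := by
  have : (1 : ℝ) - x ^ 2 ≠ 0 := (one_sub_sq_pos hx).ne'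
  field_simp
  ring

theorem legendreQOne_hasDerivAt {x : ℝ} (hx : x ∈ Ioo (-1 : ℝ) 1) :
    HasDerivAt (fun y => y * legendreQZero y - 1) (x * (1 - x ^ 2)⁻¹ + legendreQZero x) x := by
  refine (((hasDerivAt_id x).mul (legendreQZero_hasDerivAt hx)).sub_const 1).congr_deriv ?_
  simp only [id]
  ring

theorem legendreQ_hasDerivAt (l : ℕ) {x : ℝ} (hx : x ∈ Ioo (-1 : ℝ) 1) :
    HasDerivAt (legendreQ l) (legendreQD l x) x :=
  bonnet_hasDerivAt (legendreQZero_hasDerivAt hx) (legendreQOne_hasDerivAt hx)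
    (legendreQ_seed hx) l

theorem legendreQD_hasDerivAt (l : ℕ) {x : ℝ} (hx : x ∈ Ioo (-1 : ℝ) 1) :
    HasDerivAt (legendreQD l) (legendreQDD l x) x := by
  refine bonnetD_hasDerivAt (a' := fun x => (1 - x ^ 2)⁻¹) (legendreQZero_hasDerivAt hx)
    (legendreQOne_hasDerivAt hx) (legendreQ_seed hx) ?_ l
  have h1 : (1 : ℝ) - x ^ 2 ≠ 0 := (one_sub_sq_pos hx).ne'
  refine ((((hasDerivAt_id x).pow 2).const_sub 1).inv h1).congr_deriv ?_
  simp [div_eq_mul_inv]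

theorem legendreQ_ode (l : ℕ) {x : ℝ} (hx : x ∈ Ioo (-1 : ℝ) 1) :
    (1 - x ^ 2) * legendreQDD l x - 2 * x * legendreQD l x
      + (l : ℝ) * ((l : ℝ) + 1) * legendreQ l x = 0 := by
  refine bonnetDD_legendre (legendreQ_seed hx) ?_ l
  have h1 : (1 : ℝ) - x ^ 2 ≠ 0 := (one_sub_sq_pos hx).ne'
  field_simp
  ring

theorem legendreQ_contDiffOn (l : ℕ) : ContDiffOn ℝ ∞ (legendreQ l) (Ioo (-1) 1) :=
  bonnet_contDiffOn legendreQZero_contDiffOn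
    ((contDiffOn_id.mul legendreQZero_contDiffOn).sub contDiffOn_const) l

theorem legendre_wronskian (l : ℕ) {x : ℝ} (hx : x ∈ Ioo (-1 : ℝ) 1) :
    (1 - x ^ 2) * (legendreP l x * legendreQD l x - legendreQ l x * legendrePD l x) = 1 := by
  have h1 : (1 - x ^ 2) * legendrePD l x = ((l : ℝ) + 1) * (x * legendreP l x
    - legendreP (l + 1) x) := one_sub_sq_mul_bonnetD (by ring) l
  have h2 : (1 - x ^ 2) * legendreQD l x = ((l : ℝ) + 1) * (x * legendreQ l x
    - legendreQ (l + 1) x) := one_sub_sq_mul_bonnetD (legendreQ_seed hx) l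
  have h3 : ((l : ℝ) + 1) * (legendreQ l x * legendreP (l + 1) x
      - legendreP l x * legendreQ (l + 1) x) = legendreQZero x * x
        - 1 * (x * legendreQZero x - 1) := bonnet_casoratian _ _ _ _ _ l
  linear_combination legendreP l x * h2 - legendreQ l x * h1 + h3

/-! ### Mode functions -/

/-- `g` is the derivative of `f` on `(0, π)`, and `f` solves `f̈ + cot t ḟ + (λ² - 1/4) f = 0`
there. -/
structure IsModeSolution (lam : ℝ) (f g : ℝ → ℝ) : Prop where
  deriv_fst : ∀ t ∈ Ioo 0 π, HasDerivAt f (g t) t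
  deriv_snd : ∀ t ∈ Ioo 0 π, HasDerivAt g (-(Real.cot t * g t) - (lam ^ 2 - 1 / 4) * f t) t

theorem IsModeSolution.lincomb {lam : ℝ} {f₁ g₁ f₂ g₂ : ℝ → ℝ} (h₁ : IsModeSolution lam f₁ g₁)
    (h₂ : IsModeSolution lam f₂ g₂) (a b : ℝ) :
    IsModeSolution lam (fun t => a * f₁ t + b * f₂ t) (fun t => a * g₁ t + b * g₂ t) where
  deriv_fst t ht := ((h₁.deriv_fst t ht).const_mul a).add ((h₂.deriv_fst t ht).const_mul b)
  deriv_snd t ht := (((h₁.deriv_snd t ht).const_mul a).add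
    ((h₂.deriv_snd t ht).const_mul b)).congr_deriv (by ring)

theorem cos_mem_Ioo {t : ℝ} (ht : t ∈ Ioo 0 π) : Real.cos t ∈ Ioo (-1 : ℝ) 1 := by
  have h := Real.sin_pos_of_mem_Ioo ht
  have h2 := Real.sin_sq_add_cos_sq t
  constructor <;> nlinarith

/-- The substitution x = cos t turns Legendre's equation into the mode equation; the frequency is ℓ
+ 1/2 because (ℓ + 1/2)² - 1/4 = ℓ(ℓ + 1). -/
theorem isModeSolution_comp_cos {l : ℕ} {X X' X'' : ℝ → ℝ}
    (h₁ : ∀ x ∈ Ioo (-1 : ℝ) 1, HasDerivAt X (X' x) x)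
    (h₂ : ∀ x ∈ Ioo (-1 : ℝ) 1, HasDerivAt X' (X'' x) x)
    (h₃ : ∀ x ∈ Ioo (-1 : ℝ) 1,
      (1 - x ^ 2) * X'' x - 2 * x * X' x + (l : ℝ) * ((l : ℝ) + 1) * X x = 0) (c : ℝ) :
    IsModeSolution ((l : ℝ) + 1 / 2) (fun t => c * X (Real.cos t))
      (fun t => c * (X' (Real.cos t) * -Real.sin t)) where
  deriv_fst t ht := ((h₁ _ (cos_mem_Ioo ht)).comp t (Real.hasDerivAt_cos t)).const_mul c
  deriv_snd t ht := by
    refine ((((h₂ _ (cos_mem_Ioo ht)).comp t (Real.hasDerivAt_cos t)).mul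
      (Real.hasDerivAt_sin t).neg).const_mul c).congr_deriv ?_
    have h := (Real.sin_pos_of_mem_Ioo ht).ne'
    have h4 := h₃ _ (cos_mem_Ioo ht)
    have h5 : Real.cot t * Real.sin t = Real.cos t := by
      rw [Real.cot_eq_cos_div_sin, div_mul_cancel₀ _ h]
    simp only [Function.comp, Pi.neg_apply]
    linear_combination c * h4 + c * X'' (Real.cos t) * Real.sin_sq_add_cos_sq t
      - c * X' (Real.cos t) * h5

/-- The derivative of `u_{0ℓ}`. -/
def u0' (l : ℕ) (t : ℝ) : ℝ := 1 / √2 * (legendrePD l (Real.cos t) * -Real.sin t)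

/-- The derivative of `v_{0ℓ}`. -/
def v0' (l : ℕ) (t : ℝ) : ℝ := 1 / √2 * (legendreQD l (Real.cos t) * -Real.sin t)

theorem u0_isModeSolution (l : ℕ) : IsModeSolution ((l : ℝ) + 1 / 2) (u0 l) (u0' l) :=
  isModeSolution_comp_cos (fun x _ => legendreP_hasDerivAt l x)
    (fun x _ => legendrePD_hasDerivAt l x) (fun x _ => legendreP_ode l x) _

theorem v0_isModeSolution (l : ℕ) : IsModeSolution ((l : ℝ) + 1 / 2) (v0 l) (v0' l) :=
  isModeSolution_comp_cos (fun _ hx => legendreQ_hasDerivAt l hx)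
    (fun _ hx => legendreQD_hasDerivAt l hx) (fun _ hx => legendreQ_ode l hx) _

/-- The sign comes from differentiating cos t, the factor 1/2 from the two normalisations 1/√2. -/
theorem mode_wronskian (l : ℕ) {t : ℝ} (ht : t ∈ Ioo 0 π) :
    Real.sin t * (u0 l t * v0' l t - u0' l t * v0 l t) = -(1 / 2) := by
  have h := legendre_wronskian l (cos_mem_Ioo ht)
  have h2 := Real.sin_sq_add_cos_sq t
  have h3 : (1 / √2) * (1 / √2) = 1 / 2 := by
    rw [div_mul_div_comm, Real.mul_self_sqrt (by norm_num)]; norm_num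
  simp only [u0, v0, u0', v0']
  set P := legendreP l (Real.cos t)
  set P' := legendrePD l (Real.cos t)
  set Q := legendreQ l (Real.cos t)
  set Q' := legendreQD l (Real.cos t)
  have h4 : 1 - Real.cos t ^ 2 = Real.sin t ^ 2 := by linarith
  rw [h4] at h
  linear_combination (-(1 / 2)) * h - Real.sin t ^ 2 * (P * Q' - Q * P') * h3

theorem u0_contDiffOn (l : ℕ) : ContDiffOn ℝ ∞ (u0 l) (Ioo 0 π) :=
  contDiffOn_const.mul ((legendreP_contDiff l).comp Real.contDiff_cos).contDiffOn

theorem v0_contDiffOn (l : ℕ) : ContDiffOn ℝ ∞ (v0 l) (Ioo 0 π) :=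
  contDiffOn_const.mul ((legendreQ_contDiffOn l).comp Real.contDiff_cos.contDiffOn
    fun _ ht => cos_mem_Ioo ht)

/-! ### Asymptotics of mode solutions -/

/-- Gronwall's inequality for ζ - ζ(0), with inhomogeneity κ‖ζ(0)‖, gives (exp κ - 1)‖ζ(0)‖. The
cruder factor κ exp κ displays the smallness in κ. -/
theorem norm_sub_le_of_norm_deriv_le {ζ ζ' : ℝ → ℂ} {κ : ℝ} (hκ : 0 ≤ κ)
    (hζ : ∀ σ ∈ Icc (0 : ℝ) 1, HasDerivAt ζ (ζ' σ) σ)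
    (h : ∀ σ ∈ Icc (0 : ℝ) 1, ‖ζ' σ‖ ≤ κ * ‖ζ σ‖) :
    ‖ζ 1 - ζ 0‖ ≤ κ * Real.exp κ * ‖ζ 0‖ := by
  have h1 := norm_le_gronwallBound_of_norm_deriv_right_le (f := fun σ => ζ σ - ζ 0) (f' := ζ')
    (δ := 0) (K := κ) (ε := κ * ‖ζ 0‖) (a := 0) (b := 1)
    (fun σ hσ => ((hζ σ hσ).sub_const _).continuousAt.continuousWithinAt)
    (fun σ hσ => ((hζ σ (Ico_subset_Icc_self hσ)).sub_const _).hasDerivWithinAt) (by simp)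
    (fun σ hσ => by
      have h2 := h σ (Ico_subset_Icc_self hσ)
      have h3 : ‖ζ σ‖ ≤ ‖ζ σ - ζ 0‖ + ‖ζ 0‖ := by
        simpa using norm_add_le (ζ σ - ζ 0) (ζ 0)
      nlinarith) 1 (by simp)
  refine h1.trans ?_
  rcases hκ.eq_or_lt with rfl | hκ'
  · simp [gronwallBound_K0]
  · rw [gronwallBound_of_K_ne_0 hκ'.ne']
    have h4 : Real.exp κ - 1 ≤ κ * Real.exp κ := by
      have h5 := Real.add_one_le_exp (-κ)
      have h6 : Real.exp (-κ) * Real.exp κ = 1 := by rw [← Real.exp_add]; simp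
      nlinarith [Real.exp_pos κ]
    have h7 : κ * ‖ζ 0‖ / κ = ‖ζ 0‖ := by field_simp
    simp only [zero_mul, h7, zero_add, sub_zero, mul_one]
    nlinarith [norm_nonneg (ζ 0)]

section WKB

variable {lam : ℝ} {f g : ℝ → ℝ}

theorem IsModeSolution.hasDerivAt_sqrt_sin_mul (h : IsModeSolution lam f g) {t : ℝ}
    (ht : t ∈ Ioo 0 π) :
    HasDerivAt (fun t => √(Real.sin t) * f t)
      (√(Real.sin t) * g t + Real.cos t / (2 * √(Real.sin t)) * f t) t := by
  have hs := Real.sin_pos_of_mem_Ioo ht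
  refine (((Real.hasDerivAt_sin t).sqrt hs.ne').mul (h.deriv_fst t ht)).congr_deriv ?_
  ring

/-- Liouville normal form: the factor √sin t removes the damping term and leaves a harmonic
oscillator whose potential 1/(4 sin² t) does not depend on λ. -/
theorem IsModeSolution.hasDerivAt_sqrt_sin_mul_snd (h : IsModeSolution lam f g) {t : ℝ}
    (ht : t ∈ Ioo 0 π) :
    HasDerivAt (fun t => √(Real.sin t) * g t + Real.cos t / (2 * √(Real.sin t)) * f t)
      (-((lam ^ 2 + 1 / (4 * Real.sin t ^ 2)) * (√(Real.sin t) * f t))) t := by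
  have hs := Real.sin_pos_of_mem_Ioo ht
  have hr : 0 < √(Real.sin t) := Real.sqrt_pos.2 hs
  have hd := (Real.hasDerivAt_sin t).sqrt hs.ne'
  refine ((hd.mul (h.deriv_snd t ht)).add (((Real.hasDerivAt_cos t).div (hd.const_mul 2)
    (by positivity)).mul (h.deriv_fst t ht))).congr_deriv ?_
  have h2 : √(Real.sin t) ^ 2 = Real.sin t := Real.sq_sqrt hs.le
  rw [Real.cot_eq_cos_div_sin]
  have h3 := Real.sin_sq_add_cos_sq t
  set r := √(Real.sin t)
  simp only [Pi.div_apply, ← h2, Real.sqrt_sq hr.le] at h3 ⊢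
  field_simp
  have h4 : Real.cos t ^ 2 = 1 - r ^ 4 := by linear_combination h3
  ring_nf
  simp only [h4]
  ring

/-- The rotating complex amplitude of a mode solution. -/
def amplitude (lam t₀ : ℝ) (f g : ℝ → ℝ) (t : ℝ) : ℂ :=
  (((√(Real.sin t) * f t : ℝ) : ℂ) + Complex.I / lam *
    ((√(Real.sin t) * g t + Real.cos t / (2 * √(Real.sin t)) * f t : ℝ) : ℂ)) *
    Complex.exp (Complex.I * lam * (t - t₀))

/-- The rotating phase cancels the free motion. Only the potential remains, divided by λ, so the
amplitude drifts by O(1/λ). -/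
theorem IsModeSolution.hasDerivAt_amplitude (h : IsModeSolution lam f g) (hl : lam ≠ 0) (t₀ : ℝ)
    {t : ℝ} (ht : t ∈ Ioo 0 π) :
    HasDerivAt (amplitude lam t₀ f g)
      (-(Complex.I / lam) * ((1 / (4 * Real.sin t ^ 2) * (√(Real.sin t) * f t) : ℝ) : ℂ) *
        Complex.exp (Complex.I * lam * (t - t₀))) t := by
  have h1 := (h.hasDerivAt_sqrt_sin_mul ht).ofReal_comp
  have h2 := (h.hasDerivAt_sqrt_sin_mul_snd ht).ofReal_comp
  have h3 : HasDerivAt (fun t : ℝ => Complex.exp (Complex.I * lam * (t - t₀)))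
      (Complex.exp (Complex.I * lam * (t - t₀)) * (Complex.I * lam * 1)) t :=
    ((((hasDerivAt_id t).ofReal_comp).sub_const (t₀ : ℂ)).const_mul (Complex.I * lam)).cexp
  refine ((h1.add (h2.const_mul (Complex.I / lam))).mul h3).congr_deriv ?_
  have hl' : (lam : ℂ) ≠ 0 := by exact_mod_cast hl
  simp only [Pi.add_apply]
  generalize √(Real.sin t) * f t = a
  generalize √(Real.sin t) * g t + Real.cos t / (2 * √(Real.sin t)) * f t = b
  generalize 1 / (4 * Real.sin t ^ 2) = c
  push_cast
  field_simp
  linear_combination (lam * b : ℂ) * Complex.I_sq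

theorem norm_exp_I_mul_real (x y : ℝ) :
    ‖Complex.exp (Complex.I * x * y)‖ = 1 := by
  have : Complex.I * x * y = ((x * y : ℝ) : ℂ) * Complex.I := by push_cast; ring
  rw [this, Complex.norm_exp_ofReal_mul_I]

theorem abs_le_norm_amplitude (lam t₀ : ℝ) (f g : ℝ → ℝ) (t : ℝ) :
    |√(Real.sin t) * f t| ≤ ‖amplitude lam t₀ f g t‖ := by
  have h1 := norm_exp_I_mul_real lam (t - t₀)
  push_cast at h1
  rw [amplitude, norm_mul, h1, mul_one]
  refine le_trans (le_of_eq ?_) (Complex.abs_re_le_norm _)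
  congr 1
  rw [div_mul_eq_mul_div, mul_div_assoc, ← Complex.ofReal_div]
  simp only [Complex.add_re, Complex.ofReal_re, Complex.I_mul_re, Complex.ofReal_im, neg_zero,
    add_zero]

/-- At a fixed time `t`, a mode solution of frequency `λ` is a free oscillation of the same Cauchy
data at `t₀` up to a relative error `O(1 / λ)`. -/
theorem exists_modeSolution_asymptotics {t₀ t : ℝ} (ht₀ : t₀ ∈ Ioo 0 π) (ht : t ∈ Ioo 0 π) :
    -- The constant is chosen before λ and the solution; this uniformity is what allows the bound to
    -- be used for all modes at once.
    ∃ C : ℝ, 0 ≤ C ∧ ∀ (lam : ℝ) (f g : ℝ → ℝ), 1 / 2 ≤ lam → IsModeSolution lam f g →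
      ‖(√(Real.sin t) : ℂ) * (f t + Complex.I / lam * g t)
        - √(Real.sin t₀) * (f t₀ + Complex.I / lam * g t₀) *
          Complex.exp (-(Complex.I * lam * (t - t₀)))‖ ≤ C / lam * (|f t₀| + |g t₀| / lam) := by
  have hseg : ∀ σ ∈ Icc (0 : ℝ) 1, t₀ + σ * (t - t₀) ∈ Ioo 0 π := fun σ hσ => by
    have := (convex_Ioo 0 π) ht₀ ht (sub_nonneg.2 hσ.2) hσ.1 (by ring)
    simpa [smul_eq_mul, sub_mul, mul_sub, sub_add_eq_add_sub, add_sub_assoc] using this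
  -- The segment from t₀ to t is parametrised by [0, 1], which covers both time orders; the
  -- potential on it is bounded through the minimum m of sin.
  obtain ⟨σ₀, hσ₀, hmin⟩ := isCompact_Icc.exists_isMinOn (nonempty_Icc.2 zero_le_one)
    (f := fun σ : ℝ => Real.sin (t₀ + σ * (t - t₀))) (by fun_prop)
  set m := Real.sin (t₀ + σ₀ * (t - t₀)) with hm
  have hm0 : 0 < m := Real.sin_pos_of_mem_Ioo (hseg σ₀ hσ₀)
  have hs := Real.sin_pos_of_mem_Ioo ht
  have hs0 := Real.sin_pos_of_mem_Ioo ht₀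
  set r := √(Real.sin t) with hr
  set r₀ := √(Real.sin t₀) with hr0
  have hrpos : 0 < r := Real.sqrt_pos.2 hs
  have hr0pos : 0 < r₀ := Real.sqrt_pos.2 hs0
  have hr01 : r₀ ≤ 1 := Real.sqrt_le_one.2 (Real.sin_le_one _)
  set κ₁ := |t - t₀| / (4 * m ^ 2) with hκ₁
  have hκ₁0 : 0 ≤ κ₁ := by positivity
  set A := 1 + 1 / r₀ with hA
  set X := Real.exp (2 * κ₁) with hX
  -- The three summands bound the drift of the amplitude and the two terms cos/(2√sin) · f / λ, at t
  -- and at t₀, coming from the derivative of √sin; see `e3`, `e1`, `e2`.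
  refine ⟨A * (κ₁ * X) + (1 + 2 * κ₁ * X) * A / r ^ 2 + 1 / r₀, by positivity,
    fun lam f g hlam h => ?_⟩
  have hl0 : 0 < lam := by linarith
  set E := |f t₀| + |g t₀| / lam with hE
  have hE0 : 0 ≤ E := by positivity
  set Z := amplitude lam t₀ f g with hZ
  set κ := κ₁ / lam with hκ
  have hκ0 : 0 ≤ κ := by positivity
  have hκ2 : κ ≤ 2 * κ₁ := by
    rw [hκ, div_le_iff₀ hl0]; nlinarith
  have key := norm_sub_le_of_norm_deriv_le (ζ := fun σ => Z (t₀ + σ * (t - t₀)))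
    (ζ' := fun σ => (t - t₀) • (-(Complex.I / lam) * ((1 / (4 * Real.sin (t₀ + σ * (t - t₀)) ^ 2)
      * (√(Real.sin (t₀ + σ * (t - t₀))) * f (t₀ + σ * (t - t₀))) : ℝ) : ℂ) *
        Complex.exp (Complex.I * lam * ((t₀ + σ * (t - t₀) : ℝ) - t₀)))) hκ0
    (fun σ hσ => by
      have h1 := h.hasDerivAt_amplitude hl0.ne' t₀ (hseg σ hσ)
      have h2 : HasDerivAt (fun σ : ℝ => t₀ + σ * (t - t₀)) (t - t₀) σ := by
        simpa using ((hasDerivAt_id σ).mul_const (t - t₀)).const_add t₀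
      exact h1.scomp σ h2)
    (fun σ hσ => by
      have h1 := norm_exp_I_mul_real lam (t₀ + σ * (t - t₀) - t₀)
      have h2 := abs_le_norm_amplitude lam t₀ f g (t₀ + σ * (t - t₀))
      have h3 : m ≤ Real.sin (t₀ + σ * (t - t₀)) := hmin hσ
      push_cast at h1 ⊢
      rw [norm_smul, norm_mul, norm_mul, h1, mul_one, norm_neg, norm_div, Complex.norm_I,
        Complex.norm_real, ← Complex.ofReal_mul, norm_mul, Complex.norm_real]
      have h4 : ‖(1 : ℂ) / (4 * Complex.sin (t₀ + σ * (t - t₀)) ^ 2)‖ ≤ 1 / (4 * m ^ 2) := by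
        have : (1 : ℂ) / (4 * Complex.sin (t₀ + σ * (t - t₀)) ^ 2)
          = ((1 / (4 * Real.sin (t₀ + σ * (t - t₀)) ^ 2) : ℝ) : ℂ) := by push_cast; rfl
        rw [this, Complex.norm_real, Real.norm_of_nonneg (by positivity)]
        gcongr
      rw [Real.norm_eq_abs, Real.norm_eq_abs, Real.norm_eq_abs, abs_of_pos hl0]
      calc |t - t₀| * (1 / lam * (‖(1 : ℂ) / (4 * Complex.sin (t₀ + σ * (t - t₀)) ^ 2)‖ * _))
          ≤ |t - t₀| * (1 / lam * (1 / (4 * m ^ 2) * ‖Z (t₀ + σ * (t - t₀))‖)) := by gcongr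
        _ = κ * ‖Z (t₀ + σ * (t - t₀))‖ := by rw [hκ, hκ₁]; field_simp)
  simp only [zero_mul, add_zero, one_mul, add_sub_cancel] at key
  have hkey : ‖Z t - Z t₀‖ ≤ κ₁ * X / lam * ‖Z t₀‖ := by
    refine key.trans ?_
    rw [hκ, div_mul_eq_mul_div]
    gcongr
    exact Real.exp_le_exp.2 hκ2
  have hZ0 : ‖Z t₀‖ ≤ A * E := by
    have : Z t₀ = ((r₀ * f t₀ : ℝ) : ℂ) + Complex.I *
      (((r₀ * g t₀ + Real.cos t₀ / (2 * r₀) * f t₀) / lam : ℝ) : ℂ) := by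
      simp only [hZ, amplitude, sub_self, mul_zero, Complex.exp_zero, mul_one]
      push_cast
      ring
    rw [this]
    refine (norm_add_le _ _).trans ?_
    rw [norm_mul, Complex.norm_I, one_mul, Complex.norm_real, Complex.norm_real, norm_mul,
      norm_div, Real.norm_of_nonneg hr0pos.le, Real.norm_of_nonneg hl0.le, Real.norm_eq_abs,
      Real.norm_eq_abs]
    have h1 : |r₀ * g t₀ + Real.cos t₀ / (2 * r₀) * f t₀| ≤ |g t₀| + |f t₀| / (2 * r₀) := by
      refine (abs_add_le _ _).trans ?_
      rw [abs_mul, abs_mul, abs_div, abs_of_pos hr0pos, abs_of_pos (by positivity : 0 < 2 * r₀)]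
      have := Real.abs_cos_le_one t₀
      have h2 : |Real.cos t₀| / (2 * r₀) * |f t₀| ≤ 1 / (2 * r₀) * |f t₀| := by gcongr
      have h3 : r₀ * |g t₀| ≤ 1 * |g t₀| := by gcongr
      calc _ ≤ 1 * |g t₀| + 1 / (2 * r₀) * |f t₀| := by linarith
        _ = _ := by ring
    calc r₀ * |f t₀| + |r₀ * g t₀ + Real.cos t₀ / (2 * r₀) * f t₀| / lam
        ≤ 1 * |f t₀| + (|g t₀| + |f t₀| / (2 * r₀)) / lam := by gcongr
      _ = |f t₀| + |g t₀| / lam + |f t₀| / r₀ * (1 / 2 / lam) := by field_simp; ring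
      _ ≤ |f t₀| + |g t₀| / lam + |f t₀| / r₀ * 1 := by
          gcongr
          rw [div_le_one hl0]; exact hlam
      _ ≤ |f t₀| + |g t₀| / lam + E / r₀ * 1 := by
          gcongr
          exact le_add_of_nonneg_right (by positivity)
      _ = A * E := by rw [hA, hE]; ring
  have hZt : ‖Z t‖ ≤ (1 + 2 * κ₁ * X) * (A * E) := by
    have h1 : ‖Z t‖ ≤ ‖Z t - Z t₀‖ + ‖Z t₀‖ := by simpa using norm_add_le (Z t - Z t₀) (Z t₀)
    have h2 : κ₁ * X / lam ≤ 2 * κ₁ * X := by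
      rw [div_le_iff₀ hl0]
      have : 0 ≤ κ₁ * X := by positivity
      nlinarith
    calc ‖Z t‖ ≤ 2 * κ₁ * X * ‖Z t₀‖ + ‖Z t₀‖ := by
          refine h1.trans (add_le_add_left (hkey.trans ?_) _)
          gcongr
      _ = (1 + 2 * κ₁ * X) * ‖Z t₀‖ := by ring
      _ ≤ _ := by gcongr
  have hft : |f t| ≤ (1 + 2 * κ₁ * X) * (A * E) / r := by
    rw [le_div_iff₀ hrpos]
    have := (abs_le_norm_amplitude lam t₀ f g t).trans hZt
    rwa [abs_mul, abs_of_pos hrpos, mul_comm] at this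
  have hn := norm_exp_I_mul_real (-lam) (t - t₀)
  push_cast at hn
  rw [mul_neg, neg_mul] at hn
  have hid : (r : ℂ) * (f t + Complex.I / lam * g t)
        - r₀ * (f t₀ + Complex.I / lam * g t₀) * Complex.exp (-(Complex.I * lam * (t - t₀)))
      = (Z t - Z t₀) * Complex.exp (-(Complex.I * lam * (t - t₀)))
        - Complex.I * ((Real.cos t / (2 * r) * f t / lam : ℝ) : ℂ)
        + Complex.I * ((Real.cos t₀ / (2 * r₀) * f t₀ / lam : ℝ) : ℂ) *
          Complex.exp (-(Complex.I * lam * (t - t₀))) := by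
    have h1 : Complex.exp (Complex.I * lam * (t - t₀)) *
      Complex.exp (-(Complex.I * lam * (t - t₀))) = 1 := by rw [← Complex.exp_add]; simp
    simp only [hZ, amplitude, sub_self, mul_zero, Complex.exp_zero, mul_one, ← hr, ← hr0]
    push_cast
    linear_combination -(r * f t + Complex.I / lam *
      (r * g t + Complex.cos t / (2 * r) * f t) : ℂ) * h1
  rw [hid]
  refine (norm_add_le _ _).trans ((add_le_add_left (norm_sub_le _ _) _).trans ?_)
  rw [norm_mul, norm_mul, norm_mul, norm_mul, hn, Complex.norm_I, Complex.norm_real,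
    Complex.norm_real]
  simp only [norm_mul, norm_div, Real.norm_eq_abs, abs_of_pos hl0, abs_of_pos hrpos,
    abs_of_pos hr0pos, mul_one, one_mul, abs_two]
  have hfE : |f t₀| ≤ E := le_add_of_nonneg_right (by positivity)
  have e1 : |Real.cos t| / (2 * r) * |f t| / lam
      ≤ 1 / (1 * r) * ((1 + 2 * κ₁ * X) * (A * E) / r) / lam := by
    have := Real.abs_cos_le_one t
    gcongr
    norm_num
  have e2 : |Real.cos t₀| / (2 * r₀) * |f t₀| / lam ≤ 1 / (1 * r₀) * E / lam := by
    have := Real.abs_cos_le_one t₀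
    gcongr
    norm_num
  have e3 : ‖Z t - Z t₀‖ ≤ κ₁ * X / lam * (A * E) := hkey.trans (by gcongr)
  calc _ ≤ κ₁ * X / lam * (A * E) + 1 / (1 * r) * ((1 + 2 * κ₁ * X) * (A * E) / r) / lam
        + 1 / (1 * r₀) * E / lam := by linarith
    _ = _ := by field_simp

end WKB

/-! ### Oscillating functions that tend to zero -/

open Filter Topology in
/-- If `p cos (λ_n (t - t₀)) + q sin (λ_n (t - t₀))` tends to zero at all points of a set while
`λ_n → ∞`, then `p` and `q` vanish almost everywhere on this set. -/
theorem ae_eq_zero_of_tendsto_oscillation {p q : ℝ → ℝ} (hp : Continuous p) (hq : Continuous q)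
    {lam : ℕ → ℝ} (hlam : Tendsto lam atTop atTop) (t₀ a b : ℝ) :
    ∀ᵐ t ∂(volume.restrict (Ioo a b)),
      Tendsto (fun n => p t * Real.cos (lam n * (t - t₀)) + q t * Real.sin (lam n * (t - t₀)))
        atTop (𝓝 0) → p t = 0 ∧ q t = 0 := by
  set G : ℕ → ℝ → ℝ := fun n t =>
    p t * Real.cos (lam n * (t - t₀)) + q t * Real.sin (lam n * (t - t₀)) with hG
  have hGc : ∀ n, Continuous (G n) := fun n => by fun_prop
  set E : Set ℝ := {t | Tendsto (fun n => G n t) atTop (𝓝 0)} with hE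
  have hEm : MeasurableSet E := measurableSet_tendsto _ fun n => (hGc n).measurable
  set S : Set ℝ := Ioo a b ∩ E with hS
  have hSm : MeasurableSet S := measurableSet_Ioo.inter hEm
  -- On S the squares `G n ^ 2` tend to zero boundedly, so their integrals do. Their mean value (p²
  -- + q²)/2 survives averaging over the oscillation, hence must integrate to zero.
  have hSsub : S ⊆ Icc a b := fun t ht => Ioo_subset_Icc_self ht.1
  have hint : ∀ {F : Type} [NormedAddCommGroup F] (f : ℝ → F), Continuous f →
      IntegrableOn f S := fun f hf =>
    (hf.continuousOn.integrableOn_Icc).mono_set hSsub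
  -- the complex amplitude
  set ζ : ℝ → ℂ := fun t => ((p t : ℂ) - Complex.I * q t) with hζ
  have hζc : Continuous ζ := by fun_prop
  have hζsq : ∀ t, ‖ζ t‖ ^ 2 = p t ^ 2 + q t ^ 2 := fun t => by
    rw [Complex.sq_norm, Complex.normSq_apply]
    simp [hζ]; ring
  have hid : ∀ n t, G n t ^ 2 = 1 / 2 * (p t ^ 2 + q t ^ 2) + 1 / 2 *
      (ζ t ^ 2 * Complex.exp (2 * lam n * (t - t₀) * Complex.I)).re := fun n t => by
    have h1 : (2 * lam n * (t - t₀) * Complex.I : ℂ) = ((2 * (lam n * (t - t₀)) : ℝ) : ℂ)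
      * Complex.I := by push_cast; ring
    rw [h1, Complex.exp_mul_I, ← Complex.ofReal_cos, ← Complex.ofReal_sin, Real.cos_two_mul,
      Real.sin_two_mul]
    simp only [hG, hζ, sq, Complex.mul_re, Complex.mul_im, Complex.sub_re, Complex.sub_im,
      Complex.ofReal_re, Complex.ofReal_im, Complex.I_re, Complex.I_im, Complex.add_re,
      Complex.add_im]
    have h2 := Real.sin_sq_add_cos_sq (lam n * (t - t₀))
    linear_combination q t ^ 2 * h2
  have h1 : Tendsto (fun n => ∫ t in S, G n t ^ 2) atTop (𝓝 0) := by
    have := tendsto_integral_of_dominated_convergence (μ := volume.restrict S)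
      (F := fun n t => G n t ^ 2) (f := fun _ => 0) (fun t => (|p t| + |q t|) ^ 2)
      (fun n => ((hGc n).pow 2).aestronglyMeasurable)
      (hint _ (by fun_prop)) (fun n => .of_forall fun t => by
        rw [norm_pow]
        gcongr
        refine (norm_add_le _ _).trans ?_
        rw [norm_mul, norm_mul]
        have h3 := Real.abs_cos_le_one (lam n * (t - t₀))
        have h4 := Real.abs_sin_le_one (lam n * (t - t₀))
        simp only [Real.norm_eq_abs]
        nlinarith [abs_nonneg (p t), abs_nonneg (q t)])
      ((ae_restrict_iff' hSm).2 (.of_forall fun t ht => by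
        have : Tendsto (fun n => G n t) atTop (𝓝 0) := ht.2
        simpa using this.pow 2))
    simpa using this
  have h2 : Tendsto (fun n => ∫ t in S, ζ t ^ 2 * Complex.exp (2 * lam n * (t - t₀) * Complex.I))
      atTop (𝓝 0) := by
    have hRL := Real.tendsto_integral_exp_smul_cocompact (S.indicator fun t => ζ t ^ 2)
    -- The Fourier kernel is exp(-2πi t w), so w = -λ/π produces the doubled frequency exp(2iλt).
    have hw : Tendsto (fun n => -(lam n / π)) atTop (cocompact ℝ) := by
      have h3 : Tendsto (fun n => -(lam n / π)) atTop atBot :=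
        tendsto_neg_atTop_atBot.comp (hlam.atTop_div_const Real.pi_pos)
      exact h3.mono_right atBot_le_cocompact
    have h4 := hRL.comp hw
    rw [tendsto_zero_iff_norm_tendsto_zero] at h4 ⊢
    refine h4.congr fun n => ?_
    have h5 : ∀ t, ζ t ^ 2 * Complex.exp (2 * lam n * (t - t₀) * Complex.I)
        = Complex.exp (Complex.I * (-2 * lam n : ℝ) * t₀) *
          (Real.fourierChar (-(t * -(lam n / π))) • ζ t ^ 2) := fun t => by
      rw [Circle.smul_def, Real.fourierChar_apply, smul_eq_mul, mul_comm _ (ζ t ^ 2),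
        mul_left_comm, ← Complex.exp_add]
      congr 2
      have : (π : ℂ) ≠ 0 := by exact_mod_cast Real.pi_ne_zero
      push_cast
      field_simp
      ring
    simp_rw [h5]
    rw [integral_const_mul, norm_mul, norm_exp_I_mul_real, one_mul, Function.comp,
      ← integral_indicator hSm]
    congr 2
    ext t
    by_cases ht : t ∈ S <;> simp [ht]
  have h3 : ∀ n, ∫ t in S, G n t ^ 2 = 1 / 2 * (∫ t in S, (p t ^ 2 + q t ^ 2)) + 1 / 2 *
      (∫ t in S, ζ t ^ 2 * Complex.exp (2 * lam n * (t - t₀) * Complex.I)).re := fun n => by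
    have hI : IntegrableOn
        (fun t : ℝ => ζ t ^ 2 * Complex.exp (2 * lam n * (t - t₀) * Complex.I)) S :=
      hint _ (by fun_prop)
    have hre : ∫ t in S, (ζ t ^ 2 * Complex.exp (2 * lam n * (t - t₀) * Complex.I)).re
      = (∫ t in S, ζ t ^ 2 * Complex.exp (2 * lam n * (t - t₀) * Complex.I)).re :=
      integral_re hI
    rw [← hre, ← integral_const_mul, ← integral_const_mul, ← integral_add]
    · exact integral_congr_ae (.of_forall fun t => hid n t)
    · exact hint (fun t => 1 / 2 * (p t ^ 2 + q t ^ 2)) (by fun_prop)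
    · exact (hI.re).const_mul (1 / 2)
  have h4 : ∫ t in S, (p t ^ 2 + q t ^ 2) = 0 := by
    have h5 : Tendsto (fun n => 1 / 2 * (∫ t in S, (p t ^ 2 + q t ^ 2)) + 1 / 2 *
      (∫ t in S, ζ t ^ 2 * Complex.exp (2 * lam n * (t - t₀) * Complex.I)).re) atTop
        (𝓝 (1 / 2 * (∫ t in S, (p t ^ 2 + q t ^ 2)) + 1 / 2 * (0 : ℂ).re)) :=
      (((Complex.continuous_re.tendsto 0).comp h2).const_mul _).const_add _
    simp_rw [h3] at h1
    have := tendsto_nhds_unique h1 h5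
    simp at this
    linarith
  rw [integral_eq_zero_iff_of_nonneg (fun t => by positivity) (hint _ (by fun_prop))] at h4
  rw [Filter.EventuallyEq, ae_restrict_iff' hSm] at h4
  rw [ae_restrict_iff' measurableSet_Ioo]
  filter_upwards [h4] with t ht hab htE
  have h5 : p t ^ 2 + q t ^ 2 = 0 := ht ⟨hab, htE⟩
  constructor <;> nlinarith [sq_nonneg (p t), sq_nonneg (q t)]

theorem ae_sin_ne (c : ℝ) : ∀ᵐ t ∂(volume.restrict (Ioo 0 π)), Real.sin t ≠ c := by
  rw [ae_restrict_iff' measurableSet_Ioo]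
  have h : ({Real.arcsin c, π - Real.arcsin c} : Set ℝ).Countable := by simp
  filter_upwards [h.ae_notMem volume] with t ht hI hc
  apply ht
  simp only [mem_insert_iff, mem_singleton_iff]
  rcases le_total t (π / 2) with h1 | h1
  · left
    rw [← hc, Real.arcsin_sin (by linarith [hI.1, Real.pi_pos]) h1]
  · right
    rw [← hc, ← Real.sin_pi_sub, Real.arcsin_sin (by linarith [hI.2]) (by linarith)]
    ring

/-! ### The real parts of the Bogoliubov coefficients -/

/-- The derivative of `modeFun`. -/
def modeFun' (ρ ν : ℕ → ℝ) (l : ℕ) (t : ℝ) : ℂ :=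
  (ρ l : ℂ) * (u0' l t : ℂ) + ((ν l : ℂ) + Complex.I * ((ρ l)⁻¹ : ℝ)) * (v0' l t : ℂ)

theorem modeFun_hasDerivAt (ρ ν : ℕ → ℝ) (l : ℕ) {t : ℝ} (ht : t ∈ Ioo 0 π) :
    HasDerivAt (modeFun ρ ν l) (modeFun' ρ ν l t) t :=
  (((u0_isModeSolution l).deriv_fst t ht).ofReal_comp.const_mul _).add
    (((v0_isModeSolution l).deriv_fst t ht).ofReal_comp.const_mul _)

theorem beta_modeFun (ρ ν : ℕ → ℝ) (l : ℕ) {t₀ t₁ : ℝ} (ht₀ : t₀ ∈ Ioo 0 π) (ht₁ : t₁ ∈ Ioo 0 π) :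
    beta (modeFun ρ ν) t₁ t₀ l = Complex.I *
      ((Real.sin t₁ : ℂ) * conj (modeFun ρ ν l t₀) * conj (modeFun' ρ ν l t₁)
        - (Real.sin t₀ : ℂ) * conj (modeFun ρ ν l t₁) * conj (modeFun' ρ ν l t₀)) := by
  rw [beta, (modeFun_hasDerivAt ρ ν l ht₀).deriv, (modeFun_hasDerivAt ρ ν l ht₁).deriv]

/-- Since Re(i w̄) = Im w, only Im(y(t₀) ẏ(t₁)) and Im(y(t₁) ẏ(t₀)) enter. In these ρ and ρ⁻¹ cancel
except in the ratio ν/ρ, and the dependence on t₁ is linear in the mode functions. -/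
theorem beta_re (ρ ν : ℕ → ℝ) (l : ℕ) (hρ : ρ l ≠ 0) {t₀ t₁ : ℝ} (ht₀ : t₀ ∈ Ioo 0 π)
    (ht₁ : t₁ ∈ Ioo 0 π) :
    (beta (modeFun ρ ν) t₁ t₀ l).re =
      Real.sin t₁ * (v0 l t₀ * u0' l t₁ + (u0 l t₀ + 2 * (ν l / ρ l) * v0 l t₀) * v0' l t₁)
      - Real.sin t₀ * (v0' l t₀ * u0 l t₁ + (u0' l t₀ + 2 * (ν l / ρ l) * v0' l t₀) * v0 l t₁) := by
  rw [beta_modeFun ρ ν l ht₀ ht₁]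
  simp only [modeFun, modeFun', map_add, map_mul, Complex.conj_ofReal, Complex.conj_I,
    Complex.mul_re, Complex.mul_im, Complex.sub_re, Complex.sub_im,
    Complex.ofReal_re, Complex.ofReal_im, Complex.I_re, Complex.I_im, Complex.add_re,
    Complex.add_im, Complex.neg_re, Complex.neg_im]
  field_simp
  ring

open Filter Topology in
/-- Dividing by its norm the rescaled Cauchy data `(λ h, ḣ, k̇ / λ)` that a mode with small
`Re β` has at `t₀` gives amplitudes of an oscillation that is small at `t₁`. -/
theorem tendsto_oscillation_of_tendsto {H K L lam : ℕ → ℝ} {h h' k k' : ℕ → ℝ → ℝ} {t₀ t₁ c : ℝ}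
    (ht₀ : t₀ ∈ Ioo 0 π) (ht₁ : t₁ ∈ Ioo 0 π)
    (hl : ∀ l, 1 / 2 ≤ lam l) (hlam : Tendsto lam atTop atTop) (hc : 0 < c)
    (hN : ∀ l, c ≤ ‖(lam l * H l, K l, L l / lam l)‖)
    (hh : ∀ l, IsModeSolution (lam l) (h l) (h' l)) (hk : ∀ l, IsModeSolution (lam l) (k l) (k' l))
    (hH : ∀ l, h l t₀ = H l) (hK : ∀ l, h' l t₀ = K l) (hK' : ∀ l, k l t₀ = K l)
    (hL : ∀ l, k' l t₀ = L l)
    (hlim : Tendsto (fun l => Real.sin t₁ * h' l t₁ - Real.sin t₀ * k l t₁) atTop (𝓝 0)) :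
    Tendsto (fun l => ‖(lam l * H l, K l, L l / lam l)‖⁻¹ *
      (K l * (Real.sin t₁ - Real.sin t₀) * Real.cos (lam l * (t₁ - t₀))
        - (lam l * H l * Real.sin t₁ + L l / lam l * Real.sin t₀) *
          Real.sin (lam l * (t₁ - t₀)))) atTop (𝓝 0) := by
  obtain ⟨C, hC, hwkb⟩ := exists_modeSolution_asymptotics ht₀ ht₁
  have hs := Real.sin_pos_of_mem_Ioo ht₁
  have hs0 := Real.sin_pos_of_mem_Ioo ht₀
  have hs1 := Real.sin_le_one t₁
  have hs01 := Real.sin_le_one t₀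
  set s := Real.sin t₁
  set s₀ := Real.sin t₀
  have hr : 0 < √s := Real.sqrt_pos.2 hs
  have hr0 : 0 < √s₀ := Real.sqrt_pos.2 hs0
  set N := fun l => ‖(lam l * H l, K l, L l / lam l)‖ with hNdef
  have hNpos : ∀ l, 0 < N l := fun l => hc.trans_le (hN l)
  have hb : ∀ l, |(N l)⁻¹ * (K l * (s - s₀) * Real.cos (lam l * (t₁ - t₀))
        - (lam l * H l * s + L l / lam l * s₀) * Real.sin (lam l * (t₁ - t₀)))|
      ≤ √s / √s₀ * c⁻¹ * |s * h' l t₁ - s₀ * k l t₁| + 4 * C / √s₀ * (lam l)⁻¹ := by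
    intro l
    have hl0 : 0 < lam l := by linarith [hl l]
    have n1 : |lam l * H l| ≤ N l := (norm_fst_le _ : _ ≤ ‖(lam l * H l, K l, L l / lam l)‖)
    have n2 : |K l| ≤ N l := (norm_fst_le _).trans
      (norm_snd_le _ : _ ≤ ‖(lam l * H l, K l, L l / lam l)‖)
    have n3 : |L l / lam l| ≤ N l := (norm_snd_le _).trans
      (norm_snd_le _ : _ ≤ ‖(lam l * H l, K l, L l / lam l)‖)
    set co := Real.cos (lam l * (t₁ - t₀))
    set si := Real.sin (lam l * (t₁ - t₀))
    have hexp : Complex.exp (-(Complex.I * lam l * (t₁ - t₀))) = co - Complex.I * si := by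
      have : (-(Complex.I * lam l * (t₁ - t₀)) : ℂ) = ((-(lam l * (t₁ - t₀)) : ℝ) : ℂ) *
        Complex.I := by push_cast; ring
      rw [this, Complex.exp_mul_I, ← Complex.ofReal_cos, ← Complex.ofReal_sin, Real.cos_neg,
        Real.sin_neg, Complex.ofReal_neg]
      ring
    -- Imaginary part of the asymptotics of h, multiplied by λ; the factor λ is absorbed because
    -- λ|H| is at most the norm `N`.
    have e1 : |√s * h' l t₁ - √s₀ * (K l * co - lam l * H l * si)| ≤ 2 * C * N l / lam l := by
      have h1 := hwkb _ _ _ (hl l) (hh l)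
      rw [hexp, hH, hK] at h1
      have h2 : (√s : ℂ) * (h l t₁ + Complex.I / lam l * h' l t₁)
          - √s₀ * (H l + Complex.I / lam l * K l) * (co - Complex.I * si)
          = ((√s * h l t₁ - √s₀ * (H l * co + K l / lam l * si) : ℝ) : ℂ) + Complex.I *
            (((√s * h' l t₁ - √s₀ * (K l * co - lam l * H l * si)) / lam l : ℝ) : ℂ) := by
        have : (lam l : ℂ) ≠ 0 := by exact_mod_cast hl0.ne'
        push_cast
        field_simp
        linear_combination (√s₀ * K l * si : ℂ) * Complex.I_sq
      rw [h2] at h1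
      have h3 := (Complex.abs_im_le_norm _).trans h1
      simp only [Complex.add_im, Complex.ofReal_im, zero_add, Complex.I_mul_im,
        Complex.ofReal_re] at h3
      rw [abs_div, abs_of_pos hl0, div_le_iff₀ hl0] at h3
      refine h3.trans ?_
      rw [abs_mul, abs_of_pos hl0] at n1
      calc C / lam l * (|H l| + |K l| / lam l) * lam l
          = C / lam l * (lam l * |H l| + |K l|) := by field_simp
        _ ≤ C / lam l * (N l + N l) := by gcongr
        _ = _ := by ring
    -- Real part of the asymptotics of k, where |L|/λ is at most `N`.
    have e2 : |√s * k l t₁ - √s₀ * (K l * co + L l / lam l * si)| ≤ 2 * C * N l / lam l := by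
      have h1 := hwkb _ _ _ (hl l) (hk l)
      rw [hexp, hK', hL] at h1
      have h2 : (√s : ℂ) * (k l t₁ + Complex.I / lam l * k' l t₁)
          - √s₀ * (K l + Complex.I / lam l * L l) * (co - Complex.I * si)
          = ((√s * k l t₁ - √s₀ * (K l * co + L l / lam l * si) : ℝ) : ℂ) + Complex.I *
            (((√s * k' l t₁ - √s₀ * (L l * co - lam l * K l * si)) / lam l : ℝ) : ℂ) := by
        have : (lam l : ℂ) ≠ 0 := by exact_mod_cast hl0.ne'
        push_cast
        field_simp
        linear_combination (√s₀ * L l * si : ℂ) * Complex.I_sq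
      rw [h2] at h1
      have h3 := (Complex.abs_re_le_norm _).trans h1
      simp only [Complex.add_re, Complex.ofReal_re, Complex.I_mul_re, Complex.ofReal_im,
        neg_zero, add_zero] at h3
      refine h3.trans ?_
      rw [abs_div, abs_of_pos hl0] at n3
      calc C / lam l * (|K l| + |L l| / lam l) ≤ C / lam l * (N l + N l) := by gcongr
        _ = _ := by ring
    set D := 2 * C * N l / lam l with hD
    set G := K l * (s - s₀) * co - (lam l * H l * s + L l / lam l * s₀) * si with hG
    set B := s * h' l t₁ - s₀ * k l t₁ with hB
    have hD0 : 0 ≤ D := (abs_nonneg _).trans e2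
    have e3 : √s₀ * |G| ≤ √s * |B| + 2 * D := by
      have : √s₀ * G = √s * B - s * (√s * h' l t₁ - √s₀ * (K l * co - lam l * H l * si))
        + s₀ * (√s * k l t₁ - √s₀ * (K l * co + L l / lam l * si)) := by
        rw [hG, hB]; ring
      rw [← abs_of_pos hr0, ← abs_mul, this]
      refine (abs_add_le _ _).trans ((add_le_add_left (abs_sub _ _) _).trans ?_)
      rw [abs_mul, abs_mul, abs_mul, abs_of_pos hr, abs_of_pos hs, abs_of_pos hs0]
      nlinarith [abs_nonneg (√s * h' l t₁ - √s₀ * (K l * co - lam l * H l * si)),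
        abs_nonneg (√s * k l t₁ - √s₀ * (K l * co + L l / lam l * si))]
    rw [abs_mul, abs_inv, abs_of_pos (hNpos l)]
    calc (N l)⁻¹ * |G| = (N l)⁻¹ * (√s₀ * |G|) / √s₀ := by field_simp
      _ ≤ (N l)⁻¹ * (√s * |B| + 2 * D) / √s₀ := by
          have := hNpos l
          gcongr
      _ = √s / √s₀ * (N l)⁻¹ * |B| + 4 * C / √s₀ * (lam l)⁻¹ := by
          have := hNpos l
          rw [hD]; field_simp; ring
      _ ≤ _ := by
          have := hN l
          gcongr
  rw [tendsto_zero_iff_abs_tendsto_zero]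
  refine squeeze_zero (fun l => abs_nonneg _) hb ?_
  have h1 := (hlim.abs.const_mul (√s / √s₀ * c⁻¹)).add
    ((tendsto_inv_atTop_zero.comp hlam).const_mul (4 * C / √s₀))
  simpa using h1

open Filter Topology in
-- The data at t₀ form a symmetric matrix with entries H, K, L whose determinant is minus the
-- squared Wronskian. Rescaling by λ preserves the determinant, so the triple cannot degenerate,
-- whatever ν/ρ does.
theorem ae_not_tendsto_beta_re (ρ ν : ℕ → ℝ) (hρ : ∀ l, 0 < ρ l) {t₀ : ℝ} (ht₀ : t₀ ∈ Ioo 0 π) :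
    ∀ᵐ t₁ ∂(volume.restrict (Ioo 0 π)),
      ¬ Tendsto (fun l : ℕ => (beta (modeFun ρ ν) t₁ t₀ l).re) atTop (𝓝 0) := by
  have hs0 := Real.sin_pos_of_mem_Ioo ht₀
  set lam : ℕ → ℝ := fun l => (l : ℝ) + 1 / 2 with hlamdef
  have hlam : Tendsto lam atTop atTop :=
    tendsto_atTop_add_const_right _ _ tendsto_natCast_atTop_atTop
  have hl : ∀ l, 1 / 2 ≤ lam l := fun l => by simp [hlamdef]
  set μ : ℕ → ℝ := fun l => ν l / ρ l
  set H : ℕ → ℝ := fun l => v0 l t₀ * u0 l t₀ + (u0 l t₀ + 2 * μ l * v0 l t₀) * v0 l t₀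
  set K : ℕ → ℝ := fun l => v0 l t₀ * u0' l t₀ + (u0 l t₀ + 2 * μ l * v0 l t₀) * v0' l t₀
  set L : ℕ → ℝ := fun l => v0' l t₀ * u0' l t₀ + (u0' l t₀ + 2 * μ l * v0' l t₀) * v0' l t₀
  set a : ℕ → ℝ × ℝ × ℝ := fun l => (lam l * H l, K l, L l / lam l) with ha
  have hN : ∀ l, 1 / 4 ≤ ‖a l‖ := by
    intro l
    have hl0 : 0 < lam l := by linarith [hl l]
    have n1 : |lam l * H l| ≤ ‖a l‖ := norm_fst_le (a l)
    have n2 : |K l| ≤ ‖a l‖ := (norm_fst_le (a l).2).trans (norm_snd_le (a l))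
    have n3 : |L l / lam l| ≤ ‖a l‖ := (norm_snd_le (a l).2).trans (norm_snd_le (a l))
    have hw := mode_wronskian l ht₀
    -- The terms with ν/ρ cancel here. Since the determinant has modulus at least 1/4, the sup norm
    -- N satisfies 2N² ≥ 1/4, and 1/4 is a convenient lower bound for N.
    have hdet : (lam l * H l) * (L l / lam l) - K l ^ 2
      = -(u0 l t₀ * v0' l t₀ - u0' l t₀ * v0 l t₀) ^ 2 := by
      field_simp
      simp only [H, K, L]
      ring
    have hw2 : 1 / 4 ≤ (u0 l t₀ * v0' l t₀ - u0' l t₀ * v0 l t₀) ^ 2 := by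
      have h1 : (Real.sin t₀) ^ 2 * (u0 l t₀ * v0' l t₀ - u0' l t₀ * v0 l t₀) ^ 2 = 1 / 4 := by
        rw [← mul_pow, hw]; norm_num
      have h2 : Real.sin t₀ ^ 2 ≤ 1 := Real.sin_sq_le_one _
      nlinarith [sq_nonneg (u0 l t₀ * v0' l t₀ - u0' l t₀ * v0 l t₀)]
    have h3 : |(lam l * H l) * (L l / lam l)| ≤ ‖a l‖ * ‖a l‖ := by
      rw [abs_mul]; gcongr
    have h4 : K l ^ 2 ≤ ‖a l‖ * ‖a l‖ := by
      rw [← sq_abs, sq]; gcongr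
    have h5 := neg_abs_le ((lam l * H l) * (L l / lam l))
    nlinarith [norm_nonneg (a l)]
  have hNpos : ∀ l, 0 < ‖a l‖ := fun l => lt_of_lt_of_le (by norm_num) (hN l)
  -- a limit point of the normalised data
  obtain ⟨x, hx, φ, hφ, hlimx⟩ := (isCompact_sphere (0 : ℝ × ℝ × ℝ) 1).tendsto_subseq
    (x := fun l => ‖a l‖⁻¹ • a l) (fun l => by
      simp [norm_smul, inv_mul_cancel₀ (hNpos l).ne'])
  have hx0 : x ≠ 0 := by
    rintro rfl
    simp at hx
  -- The limit x and the subsequence depend on t₀ only, so the exceptional null set is fixed before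
  -- t₁ is chosen.
  have hosc := ae_eq_zero_of_tendsto_oscillation
    (p := fun t => x.2.1 * (Real.sin t - Real.sin t₀))
    (q := fun t => -(x.1 * Real.sin t + x.2.2 * Real.sin t₀)) (by fun_prop) (by fun_prop)
    (hlam.comp hφ.tendsto_atTop) t₀ 0 π
  -- The second excluded value makes the sine amplitude nonzero when x.1 ≠ 0. If x.1 = 0, the
  -- quotient is 0 by convention, which sin avoids on (0, π) anyway.
  filter_upwards [hosc, ae_sin_ne (Real.sin t₀), ae_sin_ne (-(x.2.2 * Real.sin t₀) / x.1),
    ae_restrict_mem measurableSet_Ioo] with t₁ h1 h2 h3 ht₁ hlim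
  have h4 := tendsto_oscillation_of_tendsto (H := H) (K := K) (L := L) (lam := lam) ht₀ ht₁ hl hlam
    (by norm_num : (0 : ℝ) < 1 / 4) hN
    (fun l => (u0_isModeSolution l).lincomb (v0_isModeSolution l) (v0 l t₀)
      (u0 l t₀ + 2 * μ l * v0 l t₀))
    (fun l => (u0_isModeSolution l).lincomb (v0_isModeSolution l) (v0' l t₀)
      (u0' l t₀ + 2 * μ l * v0' l t₀))
    (fun l => rfl) (fun l => rfl) (fun l => by simp only [K]; ring) (fun l => rfl)
    (hlim.congr fun l => beta_re ρ ν l (hρ l).ne' ht₀ ht₁)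
  have h5 := h4.comp hφ.tendsto_atTop
  have hd : Tendsto (fun n => ‖a (φ n)‖⁻¹ • a (φ n) - x) atTop (𝓝 0) := by
    simpa using hlimx.sub_const x
  have hbd : ∀ (y : ℝ × ℝ × ℝ) (c : ℝ), |y.2.1 * (Real.sin t₁ - Real.sin t₀) * Real.cos c
      - (y.1 * Real.sin t₁ + y.2.2 * Real.sin t₀) * Real.sin c| ≤ 4 * ‖y‖ := by
    intro y c
    have n1 : |y.1| ≤ ‖y‖ := norm_fst_le y
    have n2 : |y.2.1| ≤ ‖y‖ := (norm_fst_le y.2).trans (norm_snd_le y)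
    have n3 : |y.2.2| ≤ ‖y‖ := (norm_snd_le y.2).trans (norm_snd_le y)
    have b1 := Real.abs_cos_le_one c
    have b2 := Real.abs_sin_le_one c
    have b3 := Real.abs_sin_le_one t₁
    have b4 := Real.abs_sin_le_one t₀
    calc _ ≤ |y.2.1 * (Real.sin t₁ - Real.sin t₀) * Real.cos c|
          + |(y.1 * Real.sin t₁ + y.2.2 * Real.sin t₀) * Real.sin c| := abs_sub _ _
      _ ≤ |y.2.1| * (|Real.sin t₁| + |Real.sin t₀|) * |Real.cos c|
          + (|y.1| * |Real.sin t₁| + |y.2.2| * |Real.sin t₀|) * |Real.sin c| := by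
          rw [abs_mul, abs_mul, abs_mul, ← abs_mul y.1, ← abs_mul y.2.2]
          gcongr
          · exact abs_sub _ _
          · exact abs_add_le _ _
      _ ≤ ‖y‖ * (1 + 1) * 1 + (‖y‖ * 1 + ‖y‖ * 1) * 1 := by gcongr
      _ = 4 * ‖y‖ := by ring
  have h6 : Tendsto (fun n => x.2.1 * (Real.sin t₁ - Real.sin t₀) *
      Real.cos ((lam ∘ φ) n * (t₁ - t₀)) + -(x.1 * Real.sin t₁ + x.2.2 * Real.sin t₀) *
      Real.sin ((lam ∘ φ) n * (t₁ - t₀))) atTop (𝓝 0) := by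
    have h7 : Tendsto (fun n => (‖a (φ n)‖⁻¹ • a (φ n) - x).2.1 * (Real.sin t₁ - Real.sin t₀) *
        Real.cos ((lam ∘ φ) n * (t₁ - t₀)) - ((‖a (φ n)‖⁻¹ • a (φ n) - x).1 * Real.sin t₁
          + (‖a (φ n)‖⁻¹ • a (φ n) - x).2.2 * Real.sin t₀) *
      Real.sin ((lam ∘ φ) n * (t₁ - t₀))) atTop (𝓝 0) := by
      rw [tendsto_zero_iff_abs_tendsto_zero]
      refine squeeze_zero (fun n => abs_nonneg _) (fun n => hbd _ _) ?_
      simpa using hd.norm.const_mul 4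
    have h8 := h5.sub h7
    rw [sub_zero] at h8
    refine h8.congr fun n => ?_
    simp only [Function.comp, Prod.fst_sub, Prod.snd_sub, Prod.smul_fst, Prod.smul_snd, ha,
      smul_eq_mul]
    ring
  obtain ⟨h9, h10⟩ := h1 h6
  have hK0 : x.2.1 = 0 := (mul_eq_zero.1 h9).resolve_right (sub_ne_zero.2 h2)
  have hH0 : x.1 = 0 := by
    by_contra hne
    apply h3
    rw [eq_div_iff hne]
    linarith
  have hL0 : x.2.2 = 0 := by
    rw [hH0] at h10
    simpa [hs0.ne'] using h10
  exact hx0 (Prod.ext hH0 (Prod.ext hK0 hL0))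

open Filter Topology in
theorem ae_not_summable_beta_re (ρ ν : ℕ → ℝ) (hρ : ∀ l, 0 < ρ l) {t₀ : ℝ} (ht₀ : t₀ ∈ Ioo 0 π) :
    ∀ᵐ t₁ ∂(volume.restrict (Ioo 0 π)),
      ¬ Summable (fun l : ℕ => (beta (modeFun ρ ν) t₁ t₀ l).re ^ 2) := by
  filter_upwards [ae_not_tendsto_beta_re ρ ν hρ ht₀] with t₁ h hsum
  refine h ?_
  have h1 := hsum.tendsto_atTop_zero
  rw [tendsto_zero_iff_abs_tendsto_zero]
  have h2 := (Real.continuous_sqrt.tendsto 0).comp h1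
  simpa [Function.comp_def, Real.sqrt_sq_eq_abs] using h2

/-! ### The axially symmetric spherical harmonics -/

open Filter Topology in
theorem iteratedFDeriv_two_apply_self {E F : Type*} [NormedAddCommGroup E] [NormedSpace ℝ E]
    [NormedAddCommGroup F] [NormedSpace ℝ F] {f : E → F} {x : E} (hf : ContDiffAt ℝ 2 f x) (v : E) :
    iteratedFDeriv ℝ 2 f x ![v, v] = deriv (deriv fun t : ℝ => f (x + t • v)) 0 := by
  have hline : ∀ t : ℝ, HasDerivAt (fun t : ℝ => x + t • v) v t := fun t => by
    simpa using ((hasDerivAt_id t).smul_const v).const_add x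
  have h1 : ∀ᶠ y in 𝓝 x, DifferentiableAt ℝ f y := by
    filter_upwards [hf.eventually (by simp)] with y hy
    exact hy.differentiableAt (by simp)
  have hx0 : x = x + (0 : ℝ) • v := by simp
  have h2 : ∀ᶠ t : ℝ in 𝓝 0, DifferentiableAt ℝ f (x + t • v) := by
    have h3 : Tendsto (fun t : ℝ => x + t • v) (𝓝 0) (𝓝 x) := by
      have := (hline 0).continuousAt.tendsto
      rwa [← hx0] at this
    exact h3.eventually h1
  have h4 : deriv (fun t : ℝ => f (x + t • v)) =ᶠ[𝓝 0] fun t => fderiv ℝ f (x + t • v) v := by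
    filter_upwards [h2] with t ht
    exact (ht.hasFDerivAt.comp_hasDerivAt t (hline t)).deriv
  rw [h4.deriv_eq, iteratedFDeriv_two_apply]
  have h5 : DifferentiableAt ℝ (fderiv ℝ f) (x + (0 : ℝ) • v) := by
    rw [← hx0]
    exact (hf.fderiv_right (m := 1) (by norm_num)).differentiableAt (by simp)
  have h6 : HasDerivAt (fun t : ℝ => fderiv ℝ f (x + t • v))
      (fderiv ℝ (fderiv ℝ f) (x + (0 : ℝ) • v) v) 0 :=
    h5.hasFDerivAt.comp_hasDerivAt (0 : ℝ) (hline 0)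
  have h7 : HasDerivAt (fun t : ℝ => fderiv ℝ f (x + t • v) v)
      (fderiv ℝ (fderiv ℝ f) (x + (0 : ℝ) • v) v v) 0 :=
    (ContinuousLinearMap.apply ℝ F v).hasFDerivAt.comp_hasDerivAt (0 : ℝ) h6
  rw [h7.deriv, ← hx0]
  simp

open Filter Topology in
/-- The second derivative at `0` of `X` along the normalisation of a straight line, where
`a` and `b` are the coordinates of the base point in the directions of the line and of the axis,
and `d` is the scalar product of these directions. -/
theorem deriv_deriv_comp_normalised_line {X X' X'' : ℝ → ℝ} (h₁ : ∀ x, HasDerivAt X (X' x) x)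
    (h₂ : ∀ x, HasDerivAt X' (X'' x) x) (a b d : ℝ) :
    deriv (deriv fun t : ℝ => X ((b + t * d) / √(1 + 2 * t * a + t ^ 2))) 0
      = X'' b * (d - b * a) ^ 2 + X' b * (3 * b * a ^ 2 - 2 * d * a - b) := by
  set q : ℝ → ℝ := fun t => 1 + 2 * t * a + t ^ 2 with hq
  set r : ℝ → ℝ := fun t => √(q t) with hr
  have hqd : ∀ t, HasDerivAt q (2 * (a + t)) t := fun t => by
    have := ((((hasDerivAt_id t).const_mul 2).mul_const a).const_add 1).add
      ((hasDerivAt_id t).pow 2)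
    refine this.congr_deriv ?_
    simp
    ring
  have hq0 : q 0 = 1 := by simp [hq]
  have hev : ∀ᶠ t in 𝓝 (0 : ℝ), 0 < q t :=
    (hqd 0).continuousAt.eventually (lt_mem_nhds (by rw [hq0]; norm_num))
  have hrd : ∀ t, 0 < q t → HasDerivAt r ((a + t) / r t) t := fun t ht => by
    refine ((hqd t).sqrt ht.ne').congr_deriv ?_
    have : 0 < √(q t) := Real.sqrt_pos.2 ht
    simp only [hr]
    field_simp
  have hnd : ∀ t, HasDerivAt (fun t => b + t * d) d t := fun t => by
    simpa using ((hasDerivAt_id t).mul_const d).const_add b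
  have had : ∀ t, HasDerivAt (fun t => a + t) 1 t := fun t => by
    simpa using (hasDerivAt_id t).const_add a
  have hηd : ∀ t, 0 < q t → HasDerivAt (fun t => (b + t * d) / r t)
      (d / r t - (b + t * d) * (a + t) / r t ^ 3) t := fun t ht => by
    have hpos : 0 < r t := Real.sqrt_pos.2 ht
    refine ((hnd t).div (hrd t ht) hpos.ne').congr_deriv ?_
    field_simp
  have hfd : deriv (fun t => X ((b + t * d) / r t)) =ᶠ[𝓝 0] fun t =>
      X' ((b + t * d) / r t) * (d / r t - (b + t * d) * (a + t) / r t ^ 3) := by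
    filter_upwards [hev] with t ht
    exact ((h₁ _).comp t (hηd t ht)).deriv
  have h0 : 0 < q 0 := by rw [hq0]; norm_num
  have hr0 : r 0 = 1 := by simp [hr, hq0]
  have hrne : r 0 ≠ 0 := by rw [hr0]; norm_num
  rw [hfd.deriv_eq]
  have h3 := ((h₂ _).comp 0 (hηd 0 h0)).mul
    ((((hasDerivAt_const (0 : ℝ) d)).div (hrd 0 h0) hrne).sub
    (((hnd 0).mul (had 0)).div ((hrd 0 h0).pow 3) (pow_ne_zero 3 hrne)))
  refine h3.deriv.trans ?_
  simp only [Function.comp, Pi.mul_apply, Pi.pow_apply, Pi.sub_apply, Pi.div_apply, hr0]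
  simp
  ring

theorem sum_sq_coord_S2 (s : S2) : ∑ i : Fin 3, (s : E3) i ^ 2 = 1 := by
  have h : ‖(s : E3)‖ = 1 := by simp
  rw [← EuclideanSpace.real_norm_sq_eq, h, one_pow]

theorem coe_S2_ne_zero (s : S2) : (s : E3) ≠ 0 := by
  intro h
  have h1 : ‖(s : E3)‖ = 1 := by simp
  rw [h, norm_zero] at h1
  exact zero_ne_one h1

theorem radialExtension_sphHarm (l : ℕ) {x : E3} (hx : x ≠ 0) :
    radialExtension (sphHarm l) x
      = √((2 * (l : ℝ) + 1) / (4 * π)) * legendreP l (x 2 / ‖x‖) := by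
  rw [radialExtension, dif_pos hx, sphHarm, height]
  simp [div_eq_inv_mul]

open Filter Topology in
theorem radialExtension_sphHarm_eventuallyEq (l : ℕ) (s : S2) :
    radialExtension (sphHarm l) =ᶠ[𝓝 (s : E3)]
      fun x : E3 => √((2 * (l : ℝ) + 1) / (4 * π)) * legendreP l (x 2 / ‖x‖) := by
  filter_upwards [isOpen_ne.mem_nhds (coe_S2_ne_zero s)] with x hx
  exact radialExtension_sphHarm l hx

theorem radialExtension_sphHarm_contDiffAt (l : ℕ) (s : S2) :
    ContDiffAt ℝ 2 (radialExtension (sphHarm l)) (s : E3) := by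
  refine ContDiffAt.congr_of_eventuallyEq ?_ (radialExtension_sphHarm_eventuallyEq l s)
  have h1 : ContDiffAt ℝ 2 (fun x : E3 => x 2 / ‖x‖) (s : E3) := by
    refine ContDiffAt.div ?_ (contDiffAt_norm ℝ (coe_S2_ne_zero s)) (by simp)
    exact (EuclideanSpace.proj (𝕜 := ℝ) (2 : Fin 3)).contDiff.contDiffAt
  exact contDiffAt_const.mul (((legendreP_contDiff l).of_le ENat.LEInfty.out).contDiffAt.comp _ h1)

/-- The second derivatives of the ray-constant extension along the three coordinate directions are
added. Since |s| = 1, the coefficients of P'' and P' sum to 1 - cos² θ and -2 cos θ, and Legendre's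
equation applies. -/
theorem sphereLaplacian_sphHarm (l : ℕ) (s : S2) :
    sphereLaplacian (sphHarm l) s = -((l : ℝ) * ((l : ℝ) + 1) * sphHarm l s) := by
  set c := √((2 * (l : ℝ) + 1) / (4 * π)) with hc
  have hsn : ‖(s : E3)‖ = 1 := by simp
  have heq := radialExtension_sphHarm_eventuallyEq l s
  rw [← hc] at heq
  have hsmooth : ContDiffAt ℝ 2 (fun x : E3 => c * legendreP l (x 2 / ‖x‖)) (s : E3) :=
    (radialExtension_sphHarm_contDiffAt l s).congr_of_eventuallyEq heq.symm
  rw [sphereLaplacian, InnerProductSpace.laplacian_congr_nhds heq |>.eq_of_nhds]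
  rw [congrFun (InnerProductSpace.laplacian_eq_iteratedFDeriv_orthonormalBasis _
    (EuclideanSpace.basisFun (Fin 3) ℝ)) (s : E3)]
  have hline : ∀ i : Fin 3, deriv (deriv fun t : ℝ => (fun x : E3 => c * legendreP l (x 2 / ‖x‖))
      ((s : E3) + t • EuclideanSpace.basisFun (Fin 3) ℝ i)) 0
      = c * (legendrePDD l (height s) * ((if i = 2 then 1 else 0) - height s * (s : E3) i) ^ 2
        + legendrePD l (height s) * (3 * height s * (s : E3) i ^ 2
          - 2 * (if i = 2 then 1 else 0) * (s : E3) i - height s)) := by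
    intro i
    have h1 : (fun t : ℝ => (fun x : E3 => c * legendreP l (x 2 / ‖x‖))
      ((s : E3) + t • EuclideanSpace.basisFun (Fin 3) ℝ i)) = fun t : ℝ => c * legendreP l
        ((height s + t * (if i = 2 then 1 else 0)) / √(1 + 2 * t * (s : E3) i + t ^ 2)) := by
      ext t
      have h2 : ‖(s : E3) + t • EuclideanSpace.basisFun (Fin 3) ℝ i‖
          = √(1 + 2 * t * (s : E3) i + t ^ 2) := by
        rw [← Real.sqrt_sq (norm_nonneg _), norm_add_sq_real, hsn, norm_smul, inner_smul_right]
        congr 1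
        simp [EuclideanSpace.inner_single_right]
        ring
      simp only [h2]
      congr 3
      by_cases hi : i = 2
      · subst hi; simp [height]
      · have : (2 : Fin 3) ≠ i := fun h => hi h.symm
        simp [height, hi, this]
    rw [h1]
    have h3 := deriv_deriv_comp_normalised_line (fun x => (legendreP_hasDerivAt l x).const_mul c)
      (fun x => (legendrePD_hasDerivAt l x).const_mul c) ((s : E3) i) (height s)
      (if i = 2 then 1 else 0)
    rw [h3]
    ring
  simp_rw [iteratedFDeriv_two_apply_self hsmooth, hline]
  rw [sphHarm, ← hc]
  have hsum := sum_sq_coord_S2 s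
  have hode := legendreP_ode l (height s)
  simp only [Fin.sum_univ_three] at hsum ⊢
  have h2 : (s : E3) 2 = height s := rfl
  rw [h2] at hsum ⊢
  simp
  linear_combination c * hode + c * (legendrePDD l (height s) * height s ^ 2 +
    3 * height s * legendrePD l (height s)) * hsum

theorem sphHarm_contMDiff (l : ℕ) : ContMDiff (𝓡 2) 𝓘(ℝ, ℝ) ∞ (sphHarm l) := by
  have h1 : ContMDiff (𝓡 2) 𝓘(ℝ, E3) ∞ (fun s : S2 => (s : E3)) := by
    have := Fact.mk (@finrank_euclideanSpace_fin ℝ _ (2 + 1))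
    exact contMDiff_coe_sphere
  have h2 : ContDiff ℝ ∞ (fun x : E3 => √((2 * (l : ℝ) + 1) / (4 * π)) * legendreP l (x 2)) :=
    contDiff_const.mul ((legendreP_contDiff l).comp
      (EuclideanSpace.proj (𝕜 := ℝ) (2 : Fin 3)).contDiff)
  exact h2.contMDiff.comp h1

/-! ### Solutions with a single mode -/

/-- The solution `(z y_ℓ + c.c.) Y_{ℓ0}`. -/
def singleMode (y : ℕ → ℝ → ℂ) (l : ℕ) (z : ℂ) (t : ℝ) (s : S2) : ℝ :=
  2 * (z * y l t).re * sphHarm l s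

theorem singleMode_isOneParticleVector (y : ℕ → ℝ → ℂ) (l : ℕ) (z : ℂ) :
    IsOneParticleVector y (singleMode y l z) (lp.single 2 l z) := by
  intro t _ s
  have h : ((singleMode y l z t s : ℝ) : ℂ) =
      ((lp.single 2 l z : OneParticle) l * y l t
        + (starRingEnd ℂ) ((lp.single 2 l z : OneParticle) l * y l t)) * (sphHarm l s : ℂ) := by
    rw [lp.single_apply_self, Complex.add_conj, singleMode]
    push_cast
    rfl
  rw [h]
  refine hasSum_single l fun k hk => ?_
  rw [lp.single_apply_ne _ _ _ hk]
  simp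

/-- The real part of `2 z y_ℓ` as a combination of `u_{0ℓ}` and `v_{0ℓ}`. -/
theorem two_mul_re_modeFun (ρ ν : ℕ → ℝ) (l : ℕ) (z : ℂ) (t : ℝ) :
    2 * (z * modeFun ρ ν l t).re = 2 * (z.re * ρ l) * u0 l t
      + 2 * (z.re * ν l - z.im * (ρ l)⁻¹) * v0 l t := by
  simp only [modeFun, Complex.mul_re, Complex.add_re, Complex.add_im, Complex.mul_im,
    Complex.ofReal_re, Complex.ofReal_im, Complex.I_re, Complex.I_im]
  ring

theorem two_mul_re_modeFun' (ρ ν : ℕ → ℝ) (l : ℕ) (z : ℂ) (t : ℝ) :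
    2 * (z * modeFun' ρ ν l t).re = 2 * (z.re * ρ l) * u0' l t
      + 2 * (z.re * ν l - z.im * (ρ l)⁻¹) * v0' l t := by
  simp only [modeFun', Complex.mul_re, Complex.add_re, Complex.add_im, Complex.mul_im,
    Complex.ofReal_re, Complex.ofReal_im, Complex.I_re, Complex.I_im]
  ring

theorem isModeSolution_re (ρ ν : ℕ → ℝ) (l : ℕ) (z : ℂ) :
    IsModeSolution ((l : ℝ) + 1 / 2) (fun t => 2 * (z * modeFun ρ ν l t).re)
      (fun t => 2 * (z * modeFun' ρ ν l t).re) := by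
  simp_rw [two_mul_re_modeFun, two_mul_re_modeFun']
  exact (u0_isModeSolution l).lincomb (v0_isModeSolution l) _ _

theorem deriv_singleMode (ρ ν : ℕ → ℝ) (l : ℕ) (z : ℂ) (s : S2) {t : ℝ} (ht : t ∈ Ioo 0 π) :
    deriv (fun τ => singleMode (modeFun ρ ν) l z τ s) t
      = 2 * (z * modeFun' ρ ν l t).re * sphHarm l s :=
  (((isModeSolution_re ρ ν l z).deriv_fst t ht).mul_const (sphHarm l s)).deriv

open Filter Topology in
theorem singleMode_isSolution (ρ ν : ℕ → ℝ) (l : ℕ) (z : ℂ) :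
    IsSolution (singleMode (modeFun ρ ν) l z) where
  smooth := by
    have h1 : ContDiffOn ℝ ∞ (fun t => 2 * (z * modeFun ρ ν l t).re) (Ioo 0 π) := by
      simp_rw [two_mul_re_modeFun]
      exact (contDiffOn_const.mul (u0_contDiffOn l)).add (contDiffOn_const.mul (v0_contDiffOn l))
    have h2 : ContMDiffOn (𝓘(ℝ, ℝ).prod (𝓡 2)) 𝓘(ℝ, ℝ) ∞
        (fun p : ℝ × S2 => 2 * (z * modeFun ρ ν l p.1).re) (Ioo 0 π ×ˢ univ) :=
      h1.contMDiffOn.comp contMDiffOn_fst fun p hp => hp.1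
    have h3 : ContMDiffOn (𝓘(ℝ, ℝ).prod (𝓡 2)) 𝓘(ℝ, ℝ) ∞
        (fun p : ℝ × S2 => sphHarm l p.2) (Ioo 0 π ×ˢ univ) :=
      ((sphHarm_contMDiff l).comp contMDiff_snd).contMDiffOn
    exact h2.smul h3
  field_eq t ht s := by
    have h1 : deriv (fun τ => singleMode (modeFun ρ ν) l z τ s) =ᶠ[𝓝 t]
        fun τ => 2 * (z * modeFun' ρ ν l τ).re * sphHarm l s := by
      filter_upwards [isOpen_Ioo.mem_nhds ht] with τ hτ
      exact deriv_singleMode ρ ν l z s hτ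
    have h2 := (((isModeSolution_re ρ ν l z).deriv_snd t ht).mul_const (sphHarm l s)).deriv
    have h3 : sphereLaplacian (singleMode (modeFun ρ ν) l z t) s
        = 2 * (z * modeFun ρ ν l t).re * sphereLaplacian (sphHarm l) s := by
      have h4 : radialExtension (singleMode (modeFun ρ ν) l z t)
          =ᶠ[𝓝 (s : E3)] (2 * (z * modeFun ρ ν l t).re) • radialExtension (sphHarm l) := by
        filter_upwards [isOpen_ne.mem_nhds (coe_S2_ne_zero s)] with x hx
        rw [Pi.smul_apply, radialExtension, radialExtension, dif_pos hx, dif_pos hx]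
        rfl
      have h5 : ContDiffAt ℝ 2 (radialExtension (sphHarm l)) (s : E3) :=
        radialExtension_sphHarm_contDiffAt l s
      rw [sphereLaplacian, InnerProductSpace.laplacian_congr_nhds h4 |>.eq_of_nhds,
        InnerProductSpace.laplacian_smul _ h5]
      rfl
    rw [h1.deriv_eq, deriv_singleMode ρ ν l z s ht, h2, h3, sphereLaplacian_sphHarm]
    ring
  axial t _ s s' h := by
    simp only [singleMode, sphHarm, h]

/-! ### Bogoliubov coefficients of a single mode -/

theorem modeFun_wronskian (ρ ν : ℕ → ℝ) (l : ℕ) (hρ : ρ l ≠ 0) {t : ℝ} (ht : t ∈ Ioo 0 π) :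
    (Real.sin t : ℂ) * (modeFun ρ ν l t * conj (modeFun' ρ ν l t)
      - conj (modeFun ρ ν l t) * modeFun' ρ ν l t) = Complex.I := by
  have h := mode_wronskian l ht
  have h' : (Real.sin t : ℂ) * (u0 l t * v0' l t - u0' l t * v0 l t) = -(1 / 2) := by
    rw [← Complex.ofReal_mul, ← Complex.ofReal_mul, ← Complex.ofReal_sub, ← Complex.ofReal_mul, h]
    norm_num
  have h3 : (ρ l : ℂ) * ((ρ l)⁻¹ : ℝ) = 1 := by
    rw [← Complex.ofReal_mul, mul_inv_cancel₀ hρ, Complex.ofReal_one]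
  simp only [modeFun, modeFun', map_add, map_mul, Complex.conj_ofReal, Complex.conj_I]
  linear_combination (-2 * Complex.I) * h' - 2 * Complex.I * (Real.sin t : ℂ) *
    (u0 l t * v0' l t - u0' l t * v0 l t) * h3

/-- The Bogoliubov coefficient `α_ℓ` of the evolution. -/
def alpha (ρ ν : ℕ → ℝ) (t₁ t₀ : ℝ) (l : ℕ) : ℂ :=
  Complex.I * ((Real.sin t₁ : ℂ) * conj (modeFun ρ ν l t₀) * modeFun' ρ ν l t₁
    - (Real.sin t₀ : ℂ) * modeFun ρ ν l t₁ * conj (modeFun' ρ ν l t₀))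

/-- The evolution is symplectic: expanding |α|² - |β|² leaves a multiple of the product of the
Wronskians at t₀ and t₁. -/
theorem normSq_alpha (ρ ν : ℕ → ℝ) (l : ℕ) (hρ : ρ l ≠ 0) {t₀ t₁ : ℝ} (ht₀ : t₀ ∈ Ioo 0 π)
    (ht₁ : t₁ ∈ Ioo 0 π) :
    ‖alpha ρ ν t₁ t₀ l‖ ^ 2 = 1 + ‖beta (modeFun ρ ν) t₁ t₀ l‖ ^ 2 := by
  have h0 := modeFun_wronskian ρ ν l hρ ht₀
  have h1 := modeFun_wronskian ρ ν l hρ ht₁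
  have key : alpha ρ ν t₁ t₀ l * conj (alpha ρ ν t₁ t₀ l)
      = 1 + beta (modeFun ρ ν) t₁ t₀ l * conj (beta (modeFun ρ ν) t₁ t₀ l) := by
    rw [beta_modeFun ρ ν l ht₀ ht₁, alpha]
    simp only [map_sub, map_mul, Complex.conj_I, Complex.conj_conj, Complex.conj_ofReal]
    generalize modeFun ρ ν l t₀ = y0 at *
    generalize modeFun ρ ν l t₁ = y1 at *
    generalize modeFun' ρ ν l t₀ = d0 at *
    generalize modeFun' ρ ν l t₁ = d1 at *
    generalize (Real.sin t₀ : ℂ) = s0 at *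
    generalize (Real.sin t₁ : ℂ) = s1 at *
    linear_combination (exp := 1) (Complex.I ^ 2 * (s1 * (y1 * conj d1 - conj y1 * d1))) * h0
      + (Complex.I ^ 3) * h1 + (Complex.I ^ 2 - 1) * Complex.I_sq
  rw [Complex.mul_conj, Complex.mul_conj, Complex.normSq_eq_norm_sq, Complex.normSq_eq_norm_sq]
    at key
  exact_mod_cast key

/-- At t₀ the Wronskian lets y and ȳ realise any Cauchy data; α and β are the resulting coefficients
for the data carried by y and ȳ at t₁. -/
theorem singleMode_evolves (ρ ν : ℕ → ℝ) (l : ℕ) (hρ : ρ l ≠ 0) {t₀ t₁ : ℝ} (ht₀ : t₀ ∈ Ioo 0 π)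
    (ht₁ : t₁ ∈ Ioo 0 π) (z : ℂ) :
    Evolves t₁ t₀ (singleMode (modeFun ρ ν) l z) (singleMode (modeFun ρ ν) l
      (alpha ρ ν t₁ t₀ l * z + beta (modeFun ρ ν) t₁ t₀ l * conj z)) := by
  have h0 := modeFun_wronskian ρ ν l hρ ht₀
  set w := alpha ρ ν t₁ t₀ l * z + beta (modeFun ρ ν) t₁ t₀ l * conj z with hw
  have hre : ∀ a : ℂ, ((2 * a.re : ℝ) : ℂ) = a + conj a := fun a => by
    rw [Complex.add_conj]
  have e1 : 2 * (w * modeFun ρ ν l t₀).re = 2 * (z * modeFun ρ ν l t₁).re := by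
    apply Complex.ofReal_injective
    rw [hre, hre, hw, beta_modeFun ρ ν l ht₀ ht₁, alpha]
    simp only [map_sub, map_add, map_mul, Complex.conj_I, Complex.conj_conj, Complex.conj_ofReal]
    linear_combination (-Complex.I * (z * modeFun ρ ν l t₁ + conj z * conj (modeFun ρ ν l t₁))) * h0
      - (z * modeFun ρ ν l t₁ + conj z * conj (modeFun ρ ν l t₁)) * Complex.I_sq
  have e2 : Real.sin t₀ * (2 * (w * modeFun' ρ ν l t₀).re)
      = Real.sin t₁ * (2 * (z * modeFun' ρ ν l t₁).re) := by
    apply Complex.ofReal_injective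
    rw [Complex.ofReal_mul (Real.sin t₀), Complex.ofReal_mul (Real.sin t₁), hre, hre, hw,
      beta_modeFun ρ ν l ht₀ ht₁, alpha]
    simp only [map_sub, map_add, map_mul, Complex.conj_I, Complex.conj_conj, Complex.conj_ofReal]
    linear_combination (-Complex.I * (Real.sin t₁ : ℂ) * (z * modeFun' ρ ν l t₁
      + conj z * conj (modeFun' ρ ν l t₁))) * h0
      - (Real.sin t₁ : ℂ) * (z * modeFun' ρ ν l t₁ + conj z * conj (modeFun' ρ ν l t₁))
        * Complex.I_sq
  intro s
  rw [deriv_singleMode ρ ν l z s ht₁, deriv_singleMode ρ ν l w s ht₀]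
  refine ⟨by rw [singleMode, singleMode, e1], ?_⟩
  linear_combination sphHarm l s * e2

/-! ### The exponential of a skew-symmetric operator on a dense space of analytic vectors -/

section SkewExp

variable {H : Type*} [NormedAddCommGroup H] [InnerProductSpace ℂ H]
  {D : Submodule ℂ H}

theorem sum_antidiagonal_neg_one_pow_div_factorial (n : ℕ) :
    ∑ m ∈ Finset.HasAntidiagonal.antidiagonal n,
      ((-1 : ℂ) ^ m.1 / ((m.1.factorial : ℂ) * m.2.factorial)) = if n = 0 then 1 else 0 := by
  have h := Commute.add_pow' (Commute.all (-1 : ℂ) 1) n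
  rw [neg_add_cancel] at h
  have h1 : (n.factorial : ℂ) ≠ 0 := by exact_mod_cast n.factorial_ne_zero
  have h2 : (0 : ℂ) ^ n = if n = 0 then 1 else 0 := by
    split_ifs with hn
    · simp [hn]
    · simp [hn]
  have h3 : ∑ m ∈ Finset.HasAntidiagonal.antidiagonal n,
      ((-1 : ℂ) ^ m.1 / ((m.1.factorial : ℂ) * m.2.factorial)) = (0 : ℂ) ^ n / n.factorial := by
    rw [h, Finset.sum_div]
    refine Finset.sum_congr rfl fun m hm => ?_
    rw [Finset.HasAntidiagonal.mem_antidiagonal] at hm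
    have h4 := Nat.add_choose_mul_factorial_mul_factorial m.2 m.1
    rw [add_comm, hm, mul_right_comm] at h4
    have h5 : (n.choose m.1 : ℂ) * m.1.factorial * m.2.factorial = n.factorial := by
      exact_mod_cast h4
    have h6 : (m.1.factorial : ℂ) ≠ 0 := by exact_mod_cast m.1.factorial_ne_zero
    have h7 : (m.2.factorial : ℂ) ≠ 0 := by exact_mod_cast m.2.factorial_ne_zero
    rw [← h5] at h1 ⊢
    have h8 : (n.choose m.1 : ℂ) ≠ 0 := fun h => h1 (by simp [h])
    rw [one_pow, mul_one, nsmul_eq_mul]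
    field_simp
  rw [h3, h2]
  split_ifs with hn
  · simp [hn]
  · simp

/-- All vectors of `D` are analytic for `X`. -/
def HasAnalyticVectors (X : D →ₗ[ℂ] D) : Prop :=
  ∀ x : D, Summable fun k : ℕ => ‖(k.factorial : ℂ)⁻¹ • (((X ^ k) x : D) : H)‖

/-- The exponential of `X` on its analytic vectors. -/
def expOn [CompleteSpace H] (X : D →ₗ[ℂ] D) (hX : HasAnalyticVectors X) : D →ₗ[ℂ] H where
  toFun x := ∑' k : ℕ, (k.factorial : ℂ)⁻¹ • (((X ^ k) x : D) : H)
  map_add' x y := by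
    rw [← ((hX x).of_norm).tsum_add ((hX y).of_norm)]
    simp
  map_smul' c x := by
    rw [RingHom.id_apply, ← ((hX x).of_norm).tsum_const_smul]
    refine tsum_congr fun k => ?_
    rw [map_smul, Submodule.coe_smul, smul_comm]

theorem expOn_hasSum [CompleteSpace H] (X : D →ₗ[ℂ] D) (hX : HasAnalyticVectors X) (x : D) :
    HasSum (fun k : ℕ => (k.factorial : ℂ)⁻¹ • (((X ^ k) x : D) : H)) (expOn X hX x) :=
  ((hX x).of_norm).hasSum

/-- Skew symmetry. -/
def IsSkew (X : D →ₗ[ℂ] D) : Prop :=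
  ∀ x y : D, inner ℂ (X x : H) (y : H) = -inner ℂ (x : H) (X y : H)

theorem IsSkew.pow {X : D →ₗ[ℂ] D} (h : IsSkew X) (k : ℕ) (x y : D) :
    inner ℂ (((X ^ k) x : D) : H) (y : H) = (-1) ^ k * inner ℂ (x : H) (((X ^ k) y : D) : H) := by
  induction k generalizing y with
  | zero => simp
  | succ k ih =>
    have h1 : (X ^ (k + 1)) x = X ((X ^ k) x) := by rw [pow_succ', Module.End.mul_apply]
    have h2 : (X ^ (k + 1)) y = (X ^ k) (X y) := by rw [pow_succ, Module.End.mul_apply]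
    rw [h1, h2, h, ih]
    ring

/-- Moving all powers of X to the right turns the absolutely convergent double series into a sum
over total degree n. Its coefficient is (-1 + 1)ⁿ/n!, so only n = 0 survives. -/
theorem inner_expOn_expOn [CompleteSpace H] {X : D →ₗ[ℂ] D} (hX : HasAnalyticVectors X)
    (h : IsSkew X) (x y : D) :
    inner ℂ (expOn X hX x) (expOn X hX y) = inner ℂ (x : H) (y : H) := by
  set a : ℕ → H := fun k => (k.factorial : ℂ)⁻¹ • (((X ^ k) x : D) : H) with ha
  set b : ℕ → H := fun k => (k.factorial : ℂ)⁻¹ • (((X ^ k) y : D) : H) with hb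
  set F : ℕ × ℕ → ℂ := fun p => inner ℂ (a p.1) (b p.2) with hF
  have hsum : Summable F := by
    refine Summable.of_norm_bounded ((hX x).mul_of_nonneg (hX y) (fun _ => norm_nonneg _)
      (fun _ => norm_nonneg _)) fun p => norm_inner_le_norm _ _
  have h1 : ∑' p, F p = inner ℂ (expOn X hX x) (expOn X hX y) := by
    have h2 : ∀ k, HasSum (fun j => F (k, j)) (inner ℂ (a k) (expOn X hX y)) := fun k =>
      (innerSL ℂ (a k)).hasSum (expOn_hasSum X hX y)
    have h3 : HasSum (fun k => inner ℂ (a k) (expOn X hX y))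
        (inner ℂ (expOn X hX x) (expOn X hX y)) :=
      ((innerSL ℂ).flip (expOn X hX y)).hasSum (expOn_hasSum X hX x)
    rw [hsum.tsum_prod' fun k => (h2 k).summable]
    simp_rw [fun k => (h2 k).tsum_eq]
    exact h3.tsum_eq
  rw [← h1, ← Finset.HasAntidiagonal.sigmaAntidiagonalEquivProd.tsum_eq]
  have hsum' := (Finset.HasAntidiagonal.sigmaAntidiagonalEquivProd (A := ℕ)).summable_iff.2 hsum
  refine (Summable.tsum_sigma' (fun n => (hasSum_fintype _).summable) hsum').trans ?_
  have h4 : ∀ n : ℕ, ∑' p : Finset.HasAntidiagonal.antidiagonal n,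
      F (Finset.HasAntidiagonal.sigmaAntidiagonalEquivProd ⟨n, p⟩)
        = if n = 0 then inner ℂ (x : H) (y : H) else 0 := by
    intro n
    rw [tsum_fintype]
    have h5 : ∀ p : Finset.HasAntidiagonal.antidiagonal n,
        F (Finset.HasAntidiagonal.sigmaAntidiagonalEquivProd ⟨n, p⟩)
        = ((-1 : ℂ) ^ p.1.1 / ((p.1.1.factorial : ℂ) * p.1.2.factorial)) *
          inner ℂ (x : H) (((X ^ n) y : D) : H) := by
      rintro ⟨⟨k, j⟩, hp⟩
      rw [Finset.HasAntidiagonal.mem_antidiagonal] at hp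
      simp only at hp
      subst hp
      simp only [hF, ha, hb, Finset.HasAntidiagonal.sigmaAntidiagonalEquivProd_apply]
      rw [inner_smul_left, inner_smul_right, h.pow, map_inv₀, map_natCast, pow_add,
        Module.End.mul_apply]
      field_simp
    simp_rw [h5]
    rw [← Finset.sum_mul,
      Finset.sum_coe_sort (Finset.HasAntidiagonal.antidiagonal n) fun p : ℕ × ℕ =>
      ((-1 : ℂ) ^ p.1 / ((p.1.factorial : ℂ) * p.2.factorial)),
      sum_antidiagonal_neg_one_pow_div_factorial]
    split_ifs with hn
    · subst hn; simp
    · simp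
  exact (tsum_congr h4).trans (by simp)

theorem inner_expOn_left [CompleteSpace H] {X Y : D →ₗ[ℂ] D} (hX : HasAnalyticVectors X)
    (hY : HasAnalyticVectors Y)
    (h : IsSkew X) (hXY : Y = -X) (x y : D) :
    inner ℂ (expOn X hX x) (y : H) = inner ℂ (x : H) (expOn Y hY y) := by
  have h1 := ((innerSL ℂ).flip (y : H)).hasSum (expOn_hasSum X hX x)
  have h2 := (innerSL ℂ (x : H)).hasSum (expOn_hasSum Y hY y)
  refine h1.unique (h2.congr_fun fun k => ?_)
  have h3 : (Y ^ k) y = (-1 : ℂ) ^ k • (X ^ k) y := by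
    rw [hXY, ← neg_one_smul ℂ X, smul_pow, LinearMap.smul_apply]
  change inner ℂ ((k.factorial : ℂ)⁻¹ • (((X ^ k) x : D) : H)) (y : H)
    = inner ℂ (x : H) ((k.factorial : ℂ)⁻¹ • (((Y ^ k) y : D) : H))
  rw [h3, inner_smul_left, inner_smul_right, h.pow, map_inv₀, map_natCast, Submodule.coe_smul,
    inner_smul_right]

/-- The exponentials of X and -X extend by density to isometries T and S. They need not map D into
itself, so they are not composed as series: S is the adjoint of T by `inner_expOn_left`, and adjoint
isometries are inverse to each other. -/
theorem exists_unitary_of_skew [CompleteSpace H] {X Y : D →ₗ[ℂ] D} (hD : Dense (D : Set H))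
    (hX : HasAnalyticVectors X) (hY : HasAnalyticVectors Y) (h : IsSkew X) (hXY : Y = -X) :
    ∃ V : H ≃ₗᵢ[ℂ] H, ∀ x : D,
      HasSum (fun k : ℕ => (k.factorial : ℂ)⁻¹ • (((X ^ k) x : D) : H)) (V x) ∧
      HasSum (fun k : ℕ => (k.factorial : ℂ)⁻¹ • (((Y ^ k) x : D) : H)) (V.symm x) := by
  have hYs : IsSkew Y := fun x y => by
    subst hXY
    simp [h x y]
  have hdr : DenseRange D.subtype := by
    rw [DenseRange]
    simpa using hD
  have key : ∀ (Z : D →ₗ[ℂ] D) (hZ : HasAnalyticVectors Z), IsSkew Z →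
      ∃ T : H →L[ℂ] H, ∀ x : D, T x = expOn Z hZ x := fun Z hZ hs =>
    ⟨(expOn Z hZ).extendOfNorm D.subtype, fun x => LinearMap.extendOfNorm_eq hdr ⟨1, fun x => by
      rw [one_mul, @norm_eq_sqrt_re_inner ℂ, @norm_eq_sqrt_re_inner ℂ, inner_expOn_expOn hZ hs]
      rfl⟩ x⟩
  obtain ⟨T, hT⟩ := key X hX h
  obtain ⟨S, hS⟩ := key Y hY hYs
  have hclosed : ∀ (A B C E : H →L[ℂ] H), (∀ x y : D, inner ℂ (A x) (B y) = inner ℂ (C x) (E y)) →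
      ∀ x y : H, inner ℂ (A x) (B y) = inner ℂ (C x) (E y) := fun A B C E hA x y => by
    refine hdr.induction_on₂ (p := fun x y => inner ℂ (A x) (B y) = inner ℂ (C x) (E y))
      (isClosed_eq (by fun_prop) (by fun_prop)) (fun x y => hA x y) x y
  have e1 := hclosed T T (.id ℂ H) (.id ℂ H) fun x y => by
    rw [hT, hT, inner_expOn_expOn hX h]; rfl
  have e2 := hclosed S S (.id ℂ H) (.id ℂ H) fun x y => by
    rw [hS, hS, inner_expOn_expOn hY hYs]; rfl
  have e3 := hclosed T (.id ℂ H) (.id ℂ H) S fun x y => by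
    rw [hT, hS]; exact inner_expOn_left hX hY h hXY x y
  simp only [ContinuousLinearMap.id_apply] at e1 e2 e3
  have hST : ∀ x, S (T x) = x := fun x => by
    refine ext_inner_left ℂ fun v => ?_
    rw [← e3, e1]
  have hTS : ∀ x, T (S x) = x := fun x => by
    refine ext_inner_right ℂ fun v => ?_
    rw [e3, e2]
  refine ⟨⟨⟨T.toLinearMap, S, hST, hTS⟩, fun x => ?_⟩, fun x => ⟨?_, ?_⟩⟩
  · rw [@norm_eq_sqrt_re_inner ℂ, @norm_eq_sqrt_re_inner ℂ _ _ _ _ x, ← e1 x x]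
    rfl
  · exact (hT x).symm ▸ expOn_hasSum X hX x
  · exact (hS x).symm ▸ expOn_hasSum Y hY x

end SkewExp

/-! ### Weyl operators of a single mode -/

theorem creation_single (l : ℕ) (z : ℂ) (Ψ : (ℕ →₀ ℕ) → ℂ) (n : ℕ →₀ ℕ) :
    creation (lp.single 2 l z) Ψ n = z * (√(n l : ℝ) : ℂ) * Ψ (n - Finsupp.single l 1) := by
  rw [creation, Finset.sum_eq_single l]
  · rw [lp.single_apply_self]
  · intro k _ hk
    rw [lp.single_apply_ne _ _ _ hk]
    simp
  · intro h
    rw [Finsupp.notMem_support_iff] at h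
    simp [h]

theorem annihilation_single (l : ℕ) (z : ℂ) (Ψ : (ℕ →₀ ℕ) → ℂ) (n : ℕ →₀ ℕ) :
    annihilation (lp.single 2 l z) Ψ n
      = conj z * (√((n l : ℝ) + 1) : ℂ) * Ψ (n + Finsupp.single l 1) := by
  rw [annihilation, tsum_eq_single l]
  · rw [lp.single_apply_self]
  · intro k hk
    rw [lp.single_apply_ne _ _ _ hk]
    simp

theorem fieldOperator_single_smul (l : ℕ) (z c : ℂ) (Ψ : (ℕ →₀ ℕ) → ℂ) :
    fieldOperator (lp.single 2 l z) (c • Ψ) = c • fieldOperator (lp.single 2 l z) Ψ := by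
  ext n
  simp only [fieldOperator, creation_single, annihilation_single, Pi.smul_apply, smul_eq_mul]
  ring

/-! ### Bounds for raising and lowering operators -/

/-- A weighted substitution of occupation numbers is bounded if its weights are. -/
theorem sum_norm_sq_weighted_comp_le (Ψ : Fock) {c : (ℕ →₀ ℕ) → ℝ} {σ : (ℕ →₀ ℕ) → ℕ →₀ ℕ} {M : ℝ}
    (hM : 0 ≤ M) (hc : ∀ n, Ψ (σ n) ≠ 0 → c n ^ 2 ≤ M) (hσ : InjOn σ {n | c n ≠ 0})
    (s : Finset (ℕ →₀ ℕ)) :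
    ∑ n ∈ s, ‖(c n : ℂ) * Ψ (σ n)‖ ^ (2 : ENNReal).toReal
      ≤ (√M * ‖Ψ‖) ^ (2 : ENNReal).toReal := by
  classical
  have h2 : (2 : ENNReal).toReal = 2 := by norm_num
  have h3 : (√M * ‖Ψ‖) ^ (2 : ENNReal).toReal = M * ‖Ψ‖ ^ (2 : ENNReal).toReal := by
    rw [Real.mul_rpow (Real.sqrt_nonneg _) (norm_nonneg _), h2, Real.rpow_two, Real.sq_sqrt hM]
  rw [h3]
  have h4 : ∑ n ∈ s, ‖(c n : ℂ) * Ψ (σ n)‖ ^ (2 : ENNReal).toReal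
      = ∑ n ∈ s with c n ≠ 0, ‖(c n : ℂ) * Ψ (σ n)‖ ^ (2 : ENNReal).toReal := by
    refine (Finset.sum_filter_of_ne (p := fun n => c n ≠ 0) fun n _ h hcn => h ?_).symm
    simp [hcn]
  rw [h4]
  calc ∑ n ∈ s with c n ≠ 0, ‖(c n : ℂ) * Ψ (σ n)‖ ^ (2 : ENNReal).toReal
      ≤ ∑ n ∈ s with c n ≠ 0, M * ‖Ψ (σ n)‖ ^ (2 : ENNReal).toReal := by
        refine Finset.sum_le_sum fun n _ => ?_
        rw [h2, Real.rpow_two, Real.rpow_two, norm_mul, mul_pow, Complex.norm_real,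
          Real.norm_eq_abs, sq_abs]
        by_cases h : Ψ (σ n) = 0
        · simp [h]
        · have := hc n h
          gcongr
    _ = M * ∑ m ∈ (s.filter fun n => c n ≠ 0).image σ, ‖Ψ m‖ ^ (2 : ENNReal).toReal := by
        rw [Finset.sum_image (fun a ha b hb h => hσ (by simpa using (Finset.mem_filter.1 ha).2)
          (by simpa using (Finset.mem_filter.1 hb).2) h), Finset.mul_sum]
    _ ≤ _ := by
        gcongr
        exact lp.sum_rpow_le_norm_rpow (by rw [h2]; norm_num) Ψ _

/-- Injectivity is required only where the weight is nonzero because the truncated subtraction n -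
1_ℓ of the creation operator fixes every n with n_ℓ = 0; there the weight √n_ℓ vanishes. -/
theorem weighted_comp_memℓp (Ψ : Fock) {c : (ℕ →₀ ℕ) → ℝ} {σ : (ℕ →₀ ℕ) → ℕ →₀ ℕ} {M : ℝ}
    (hM : 0 ≤ M) (hc : ∀ n, Ψ (σ n) ≠ 0 → c n ^ 2 ≤ M) (hσ : InjOn σ {n | c n ≠ 0}) :
    ∃ h : Memℓp (fun n => (c n : ℂ) * Ψ (σ n)) 2, ‖(⟨_, h⟩ : Fock)‖ ≤ √M * ‖Ψ‖ :=
  ⟨memℓp_gen' (sum_norm_sq_weighted_comp_le Ψ hM hc hσ),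
    lp.norm_le_of_forall_sum_le (by norm_num) (by positivity)
      (sum_norm_sq_weighted_comp_le Ψ hM hc hσ)⟩

/-- At most `N` particles. -/
def AtMostParticles (N : ℕ) (Ψ : Fock) : Prop := ∀ n : ℕ →₀ ℕ, N < n.degree → Ψ n = 0

theorem degree_add_single (n : ℕ →₀ ℕ) (l : ℕ) :
    (n + Finsupp.single l 1).degree = n.degree + 1 := by
  rw [map_add, Finsupp.degree_single]

theorem sub_single_add_single {n : ℕ →₀ ℕ} {l : ℕ} (h : n l ≠ 0) :
    n - Finsupp.single l 1 + Finsupp.single l 1 = n := by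
  apply tsub_add_cancel_of_le
  rw [Finsupp.single_le_iff]
  omega

theorem degree_le_sub_single (n : ℕ →₀ ℕ) (l : ℕ) :
    n.degree ≤ (n - Finsupp.single l 1).degree + 1 := by
  by_cases h : n l = 0
  · have : n - Finsupp.single l 1 = n := by
      ext k
      by_cases hk : k = l
      · subst hk; simp [h]
      · simp [Ne.symm hk]
    rw [this]
    omega
  · rw [← degree_add_single, sub_single_add_single h]

theorem AtMostParticles.exists_lower {N : ℕ} {Ψ : Fock} (hΨ : AtMostParticles N Ψ) (l : ℕ) :
    ∃ Φ : Fock, (∀ n, Φ n = (√((n l : ℝ) + 1) : ℂ) * Ψ (n + Finsupp.single l 1)) ∧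
      ‖Φ‖ ≤ √((N : ℝ) + 1) * ‖Ψ‖ := by
  obtain ⟨h, hb⟩ := weighted_comp_memℓp Ψ (c := fun n => √((n l : ℝ) + 1))
    (σ := fun n => n + Finsupp.single l 1) (M := (N : ℝ) + 1) (by positivity) (fun n hn => by
      rw [Real.sq_sqrt (by positivity)]
      have h1 : ¬ N < (n + Finsupp.single l 1).degree := fun h => hn (hΨ _ h)
      rw [degree_add_single] at h1
      have h2 := Finsupp.le_degree l n
      have h3 : n l ≤ N := by omega
      have : (n l : ℝ) ≤ N := by exact_mod_cast h3
      linarith) (fun a _ b _ hab => by simpa using hab)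
  exact ⟨⟨_, h⟩, fun n => rfl, hb⟩

theorem AtMostParticles.exists_raise {N : ℕ} {Ψ : Fock} (hΨ : AtMostParticles N Ψ) (l : ℕ) :
    ∃ Φ : Fock, (∀ n, Φ n = (√(n l : ℝ) : ℂ) * Ψ (n - Finsupp.single l 1)) ∧
      ‖Φ‖ ≤ √((N : ℝ) + 1) * ‖Ψ‖ := by
  obtain ⟨h, hb⟩ := weighted_comp_memℓp Ψ (c := fun n => √(n l : ℝ))
    (σ := fun n => n - Finsupp.single l 1) (M := (N : ℝ) + 1) (by positivity) (fun n hn => by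
      rw [Real.sq_sqrt (by positivity)]
      have h1 : ¬ N < (n - Finsupp.single l 1).degree := fun h => hn (hΨ _ h)
      have h2 := Finsupp.le_degree l n
      have h4 := degree_le_sub_single n l
      have h3 : n l ≤ N + 1 := by omega
      exact_mod_cast h3) (fun a ha b hb hab => by
      have ha' : a l ≠ 0 := fun h => ha (by simp [h])
      have hb' : b l ≠ 0 := fun h => hb (by simp [h])
      rw [← sub_single_add_single ha', ← sub_single_add_single hb']
      exact congrArg (· + Finsupp.single l 1) hab)
  exact ⟨⟨_, h⟩, fun n => rfl, hb⟩

theorem AtMostParticles.exists_fieldOperator {N : ℕ} {Ψ : Fock} (hΨ : AtMostParticles N Ψ)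
    (l : ℕ) (z : ℂ) :
    ∃ Φ : Fock, (∀ n, Φ n = Complex.I * fieldOperator (lp.single 2 l z) Ψ n) ∧
      AtMostParticles (N + 1) Φ ∧ ‖Φ‖ ≤ 2 * ‖z‖ * √((N : ℝ) + 1) * ‖Ψ‖ := by
  obtain ⟨A, hA, hAn⟩ := hΨ.exists_lower l
  obtain ⟨C, hC, hCn⟩ := hΨ.exists_raise l
  have hI := Complex.I_sq
  have hval : ∀ n, (z • C - conj z • A : Fock) n
      = Complex.I * fieldOperator (lp.single 2 l z) Ψ n := fun n => by
    rw [fieldOperator, creation_single, annihilation_single, lp.coeFn_sub, Pi.sub_apply,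
      lp.coeFn_smul, lp.coeFn_smul, Pi.smul_apply, Pi.smul_apply, hA, hC, smul_eq_mul, smul_eq_mul]
    linear_combination -(conj z * (√((n l : ℝ) + 1) : ℂ) * Ψ (n + Finsupp.single l 1)
      - z * (√(n l : ℝ) : ℂ) * Ψ (n - Finsupp.single l 1)) * hI
  refine ⟨_, hval, fun n hn => ?_, ?_⟩
  · rw [hval, fieldOperator, creation_single, annihilation_single, hΨ, hΨ]
    · simp
    · have := degree_le_sub_single n l
      omega
    · rw [degree_add_single]
      omega
  · refine (norm_sub_le _ _).trans ?_
    rw [norm_smul, norm_smul, RCLike.norm_conj]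
    nlinarith [norm_nonneg z]

/-- The vectors with finitely many particles. -/
def finiteParticle : Submodule ℂ Fock where
  carrier := {Ψ | IsFiniteParticle Ψ}
  zero_mem' := ⟨0, fun n _ => rfl⟩
  add_mem' := by
    rintro Ψ Φ ⟨N, hN⟩ ⟨M, hM⟩
    refine ⟨max N M, fun n hn => ?_⟩
    rw [lp.coeFn_add, Pi.add_apply, hN n (lt_of_le_of_lt (le_max_left _ _) hn),
      hM n (lt_of_le_of_lt (le_max_right _ _) hn), add_zero]
  smul_mem' := by
    rintro c Ψ ⟨N, hN⟩
    refine ⟨N, fun n hn => ?_⟩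
    rw [lp.coeFn_smul, Pi.smul_apply, hN n hn, smul_zero]

theorem single_mem_finiteParticle (n : ℕ →₀ ℕ) (c : ℂ) :
    (lp.single 2 n c : Fock) ∈ finiteParticle :=
  ⟨n.degree, fun m hm => lp.single_apply_ne _ _ _ (by rintro rfl; exact lt_irrefl _ hm)⟩

theorem dense_finiteParticle : Dense (finiteParticle : Set Fock) := fun Ψ =>
  mem_closure_of_tendsto (lp.hasSum_single (by norm_num) Ψ)
    (.of_forall fun s => Submodule.sum_mem _ fun n _ => single_mem_finiteParticle n _)

theorem exists_mulI_fieldOperator (l : ℕ) (z : ℂ) (Ψ : finiteParticle) :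
    ∃ Φ : finiteParticle, ∀ n, (Φ : Fock) n
      = Complex.I * fieldOperator (lp.single 2 l z) (Ψ : Fock) n := by
  obtain ⟨N, hN⟩ := Ψ.2
  obtain ⟨Φ, h1, h2, -⟩ := AtMostParticles.exists_fieldOperator hN l z
  exact ⟨⟨Φ, N + 1, h2⟩, h1⟩

/-- `i Ω̂` on the vectors with finitely many particles. -/
def fieldGeneratorFun (l : ℕ) (z : ℂ) (Ψ : finiteParticle) : finiteParticle :=
  (exists_mulI_fieldOperator l z Ψ).choose

theorem fieldGeneratorFun_apply (l : ℕ) (z : ℂ) (Ψ : finiteParticle) (n : ℕ →₀ ℕ) :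
    (fieldGeneratorFun l z Ψ : Fock) n
      = Complex.I * fieldOperator (lp.single 2 l z) (Ψ : Fock) n :=
  (exists_mulI_fieldOperator l z Ψ).choose_spec n

/-- `i Ω̂` on the vectors with finitely many particles, as a linear map. -/
def fieldGenerator (l : ℕ) (z : ℂ) : finiteParticle →ₗ[ℂ] finiteParticle where
  toFun := fieldGeneratorFun l z
  map_add' Ψ Φ := by
    ext n
    rw [Submodule.coe_add, lp.coeFn_add, Pi.add_apply, fieldGeneratorFun_apply,
      fieldGeneratorFun_apply, fieldGeneratorFun_apply]
    simp only [fieldOperator, creation_single, annihilation_single, Submodule.coe_add,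
      lp.coeFn_add, Pi.add_apply]
    ring
  map_smul' c Ψ := by
    ext n
    rw [RingHom.id_apply, Submodule.coe_smul, lp.coeFn_smul, Pi.smul_apply,
      fieldGeneratorFun_apply, fieldGeneratorFun_apply, Submodule.coe_smul, lp.coeFn_smul,
      fieldOperator_single_smul, Pi.smul_apply, smul_eq_mul, smul_eq_mul]
    ring

theorem fieldGenerator_apply (l : ℕ) (z : ℂ) (Ψ : finiteParticle) (n : ℕ →₀ ℕ) :
    (fieldGenerator l z Ψ : Fock) n = Complex.I * fieldOperator (lp.single 2 l z) (Ψ : Fock) n :=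
  fieldGeneratorFun_apply l z Ψ n

theorem fieldGenerator_apply' (l : ℕ) (z : ℂ) (Ψ : finiteParticle) (n : ℕ →₀ ℕ) :
    (fieldGenerator l z Ψ : Fock) n = z * ((√(n l : ℝ) : ℂ) * (Ψ : Fock) (n - Finsupp.single l 1))
      - conj z * ((√((n l : ℝ) + 1) : ℂ) * (Ψ : Fock) (n + Finsupp.single l 1)) := by
  rw [fieldGenerator_apply, fieldOperator, creation_single, annihilation_single]
  linear_combination (conj z * (√((n l : ℝ) + 1) : ℂ) * (Ψ : Fock) (n + Finsupp.single l 1)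
      - z * (√(n l : ℝ) : ℂ) * (Ψ : Fock) (n - Finsupp.single l 1)) * Complex.I_sq

theorem fieldGenerator_neg (l : ℕ) (z : ℂ) : fieldGenerator l (-z) = -fieldGenerator l z := by
  ext Ψ n
  rw [fieldGenerator_apply', LinearMap.neg_apply, Submodule.coe_neg, lp.coeFn_neg, Pi.neg_apply,
    fieldGenerator_apply', map_neg]
  ring

theorem fieldGenerator_bound (l : ℕ) (z : ℂ) {N : ℕ} {Ψ : finiteParticle}
    (hΨ : AtMostParticles N (Ψ : Fock)) :
    AtMostParticles (N + 1) (fieldGenerator l z Ψ : Fock) ∧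
      ‖(fieldGenerator l z Ψ : Fock)‖ ≤ 2 * ‖z‖ * √((N : ℝ) + 1) * ‖(Ψ : Fock)‖ := by
  obtain ⟨Φ, h1, h2, h3⟩ := hΨ.exists_fieldOperator l z
  have : (fieldGenerator l z Ψ : Fock) = Φ := by
    ext n
    rw [fieldGenerator_apply, h1]
  rw [this]
  exact ⟨h2, h3⟩

open Filter Topology in
-- Each application adds at most one particle and costs a factor 2‖z‖√(N + k + 1), against the k + 1
-- from the factorial. The ratio of consecutive terms therefore tends to zero.
theorem fieldGenerator_hasAnalyticVectors (l : ℕ) (z : ℂ) :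
    HasAnalyticVectors (fieldGenerator l z) := by
  intro Ψ
  obtain ⟨N, hN⟩ := Ψ.2
  have hdeg : ∀ k, AtMostParticles (N + k)
      ((((fieldGenerator l z) ^ k) Ψ : finiteParticle) : Fock) := by
    intro k
    induction k with
    | zero => rw [pow_zero]; exact hN
    | succ k ih =>
      rw [pow_succ', Module.End.mul_apply]
      exact (fieldGenerator_bound l z ih).1
  set b : ℕ → ℝ := fun k =>
    ‖(k.factorial : ℂ)⁻¹ • ((((fieldGenerator l z) ^ k) Ψ : finiteParticle) : Fock)‖ with hb
  have hbk : ∀ k, b k = (k.factorial : ℝ)⁻¹ *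
      ‖((((fieldGenerator l z) ^ k) Ψ : finiteParticle) : Fock)‖ := fun k => by
    rw [hb]
    simp only [norm_smul, norm_inv, Complex.norm_natCast]
  have hstep : ∀ k, b (k + 1) ≤ 2 * ‖z‖ * √((N : ℝ) + 1) / √((k : ℝ) + 1) * b k := by
    intro k
    have h1 := (fieldGenerator_bound l z (hdeg k)).2
    rw [hbk, hbk, pow_succ', Module.End.mul_apply, Nat.factorial_succ]
    have h2 : √(((N + k : ℕ) : ℝ) + 1) ≤ √((N : ℝ) + 1) * √((k : ℝ) + 1) := by
      rw [← Real.sqrt_mul (by positivity)]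
      apply Real.sqrt_le_sqrt
      push_cast
      nlinarith [(Nat.cast_nonneg N : (0 : ℝ) ≤ N), (Nat.cast_nonneg k : (0 : ℝ) ≤ k)]
    have hk : 0 < √((k : ℝ) + 1) := Real.sqrt_pos.2 (by positivity)
    have hk2 : √((k : ℝ) + 1) * √((k : ℝ) + 1) = (k : ℝ) + 1 := Real.mul_self_sqrt (by positivity)
    set n := ‖((((fieldGenerator l z) ^ k) Ψ : finiteParticle) : Fock)‖ with hn
    calc _ ≤ (((k + 1) * k.factorial : ℕ) : ℝ)⁻¹ *
          (2 * ‖z‖ * (√((N : ℝ) + 1) * √((k : ℝ) + 1)) * n) := by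
            gcongr
            refine h1.trans ?_
            gcongr
      _ = _ := by
          push_cast
          generalize √((k : ℝ) + 1) = r at *
          rw [← hk2]
          have : (k.factorial : ℝ) ≠ 0 := by positivity
          field_simp
  refine summable_of_ratio_norm_eventually_le (r := 1 / 2) (by norm_num) ?_
  have hlim : Tendsto (fun k : ℕ => 2 * ‖z‖ * √((N : ℝ) + 1) / √((k : ℝ) + 1)) atTop (𝓝 0) :=
    Tendsto.const_div_atTop (Real.tendsto_sqrt_atTop.comp
      (tendsto_atTop_add_const_right _ _ tendsto_natCast_atTop_atTop)) _
  filter_upwards [hlim.eventually_le_const (by norm_num : (0 : ℝ) < 1 / 2)] with k hk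
  rw [norm_norm, norm_norm]
  exact (hstep k).trans (mul_le_mul_of_nonneg_right hk (norm_nonneg _))

/-- Creation and annihilation in one mode are adjoint: reindexing by n ↦ n + 1_ℓ loses only terms
with n_ℓ = 0, which carry the weight √0. -/
theorem inner_lower_raise (l : ℕ) (Ψ Φ : (ℕ →₀ ℕ) → ℂ) :
    ∑' n : ℕ →₀ ℕ, conj ((√(n l : ℝ) : ℂ) * Ψ (n - Finsupp.single l 1)) * Φ n
      = ∑' n : ℕ →₀ ℕ, conj (Ψ n) * ((√((n l : ℝ) + 1) : ℂ) * Φ (n + Finsupp.single l 1)) := by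
  have hinj : Function.Injective fun n : ℕ →₀ ℕ => n + Finsupp.single l 1 :=
    fun a b h => by simpa using h
  rw [← hinj.tsum_eq]
  · refine tsum_congr fun n => ?_
    simp
    ring
  · intro n hn
    have h : n l ≠ 0 := fun h => hn (by simp [h])
    exact ⟨_, sub_single_add_single h⟩

theorem fieldGenerator_isSkew (l : ℕ) (z : ℂ) : IsSkew (fieldGenerator l z) := by
  intro Ψ Φ
  obtain ⟨N, hN⟩ := Ψ.2
  obtain ⟨M, hM⟩ := Φ.2
  have hN' : AtMostParticles N (Ψ : Fock) := hN
  have hM' : AtMostParticles M (Φ : Fock) := hM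
  obtain ⟨A, hA, -⟩ := hN'.exists_lower l
  obtain ⟨C, hC, -⟩ := hN'.exists_raise l
  obtain ⟨A', hA', -⟩ := hM'.exists_lower l
  obtain ⟨C', hC', -⟩ := hM'.exists_raise l
  have h1 : (fieldGenerator l z Ψ : Fock) = z • C - conj z • A := by
    ext n
    rw [fieldGenerator_apply', lp.coeFn_sub, Pi.sub_apply, lp.coeFn_smul, lp.coeFn_smul,
      Pi.smul_apply, Pi.smul_apply, hA, hC, smul_eq_mul, smul_eq_mul]
  have h2 : (fieldGenerator l z Φ : Fock) = z • C' - conj z • A' := by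
    ext n
    rw [fieldGenerator_apply', lp.coeFn_sub, Pi.sub_apply, lp.coeFn_smul, lp.coeFn_smul,
      Pi.smul_apply, Pi.smul_apply, hA', hC', smul_eq_mul, smul_eq_mul]
  have h3 : inner ℂ C (Φ : Fock) = inner ℂ (Ψ : Fock) A' := by
    rw [lp.inner_eq_tsum, lp.inner_eq_tsum]
    simp only [RCLike.inner_apply', hC, hA']
    exact inner_lower_raise l (Ψ : Fock) (Φ : Fock)
  have h4 : inner ℂ A (Φ : Fock) = inner ℂ (Ψ : Fock) C' := by
    rw [← inner_conj_symm A, ← inner_conj_symm (Ψ : Fock) C']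
    congr 1
    rw [lp.inner_eq_tsum, lp.inner_eq_tsum]
    simp only [RCLike.inner_apply', hC', hA]
    exact (inner_lower_raise l (Φ : Fock) (Ψ : Fock)).symm
  rw [h1, h2, inner_sub_left, inner_sub_right, inner_smul_left, inner_smul_left, inner_smul_right,
    inner_smul_right, h3, h4, Complex.conj_conj]
  ring

theorem fieldOperator_iterate (l : ℕ) (z : ℂ) (Ψ : finiteParticle) (k : ℕ) :
    (fieldOperator (lp.single 2 l z))^[k] ((Ψ : Fock) : (ℕ →₀ ℕ) → ℂ)
      = (-Complex.I) ^ k • (((((fieldGenerator l z) ^ k) Ψ : finiteParticle) : Fock) :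
        (ℕ →₀ ℕ) → ℂ) := by
  induction k with
  | zero => simp
  | succ k ih =>
    rw [Function.iterate_succ_apply', ih, fieldOperator_single_smul]
    ext n
    have h := fieldGenerator_apply l z (((fieldGenerator l z) ^ k) Ψ) n
    rw [pow_succ' (fieldGenerator l z), Module.End.mul_apply, Pi.smul_apply, Pi.smul_apply, h,
      pow_succ]
    simp only [smul_eq_mul]
    linear_combination ((-Complex.I) ^ k * fieldOperator (lp.single 2 l z)
      (((((fieldGenerator l z) ^ k) Ψ : finiteParticle) : Fock) : (ℕ →₀ ℕ) → ℂ) n) * Complex.I_sq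

theorem isWeylOperator_of_hasSum {l : ℕ} {z : ℂ} {V : Fock ≃ₗᵢ[ℂ] Fock}
    (h : ∀ Ψ : finiteParticle, HasSum (fun k : ℕ => (k.factorial : ℂ)⁻¹ •
      ((((fieldGenerator l z) ^ k) Ψ : finiteParticle) : Fock)) (V Ψ)) :
    IsWeylOperator (lp.single 2 l z) V := by
  intro Ψ hΨ n
  have h1 := (lp.evalCLM ℂ (fun _ : ℕ →₀ ℕ => ℂ) 2 n).hasSum (h ⟨Ψ, hΨ⟩)
  refine h1.congr_fun fun k => ?_
  have h2 := congrFun (fieldOperator_iterate l z ⟨Ψ, hΨ⟩ k) n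
  simp only at h2
  rw [h2, Pi.smul_apply, smul_eq_mul]
  have h3 : Complex.I ^ k * (-Complex.I) ^ k = 1 := by
    rw [← mul_pow, mul_neg, Complex.I_mul_I, neg_neg, one_pow]
  rw [map_smul, smul_eq_mul, div_mul_eq_mul_div, ← mul_assoc, h3, one_mul, div_eq_inv_mul]
  rfl

/-- Existence is essential: implementability quantifies over Weyl operators and would say nothing
about a mode that had none. -/
theorem exists_weylOperator (l : ℕ) (z : ℂ) :
    ∃ V : Fock ≃ₗᵢ[ℂ] Fock, IsWeylOperator (lp.single 2 l z) V ∧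
      IsWeylOperator (lp.single 2 l (-z)) V.symm := by
  obtain ⟨V, hV⟩ := exists_unitary_of_skew dense_finiteParticle
    (fieldGenerator_hasAnalyticVectors l z) (fieldGenerator_hasAnalyticVectors l (-z))
    (fieldGenerator_isSkew l z) (fieldGenerator_neg l z)
  exact ⟨V, isWeylOperator_of_hasSum fun Ψ => (hV Ψ).1,
    isWeylOperator_of_hasSum fun Ψ => (hV Ψ).2⟩

/-! ### Weyl operators on number states -/

/-- The amplitude on the `j`-th excitation of the `k`-th power of `z a† - z̄ a` on the vacuum. -/
def vacuumPower (z : ℂ) : ℕ → ℕ → ℂ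
  | 0, j => if j = 0 then 1 else 0
  | k + 1, j => z * ((√(j : ℝ) : ℂ) * vacuumPower z k (j - 1))
      - conj z * ((√((j : ℝ) + 1) : ℂ) * vacuumPower z k (j + 1))

theorem vacuumPower_succ (z : ℂ) (k j : ℕ) :
    vacuumPower z (k + 1) j = z * ((√(j : ℝ) : ℂ) * vacuumPower z k (j - 1))
      - conj z * ((√((j : ℝ) + 1) : ℂ) * vacuumPower z k (j + 1)) := rfl

/-- After division by k!, these are the coefficients of the coherent state exp(-|z|²/2) exp(z a†)|0⟩
sorted by degree in z and z̄: j net creations and i creation-annihilation pairs. -/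
theorem vacuumPower_eq (z : ℂ) (k : ℕ) : ∀ j : ℕ,
    (∀ i : ℕ, k = j + 2 * i → vacuumPower z k j
      = (k.factorial : ℂ) / i.factorial * (-(z * conj z) / 2) ^ i * z ^ j
        / (√(j.factorial : ℝ) : ℂ)) ∧
    ((∀ i : ℕ, k ≠ j + 2 * i) → vacuumPower z k j = 0) := by
  have hfac : ∀ j : ℕ, (√((j + 1).factorial : ℝ) : ℂ)
      = (√((j : ℝ) + 1) : ℂ) * (√(j.factorial : ℝ) : ℂ) := fun j => by
      rw [Nat.factorial_succ, ← Complex.ofReal_mul, ← Real.sqrt_mul (by positivity)]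
      push_cast
      rfl
  have hsq : ∀ j : ℕ, (√((j : ℝ) + 1) : ℂ) ^ 2 = (j : ℂ) + 1 := fun j => by
    rw [← Complex.ofReal_pow, Real.sq_sqrt (by positivity)]
    push_cast
    rfl
  have hne : ∀ j : ℕ, (√((j : ℝ) + 1) : ℂ) ≠ 0 := fun j => by
    exact_mod_cast (Real.sqrt_pos.2 (by positivity : (0 : ℝ) < (j : ℝ) + 1)).ne'
  have hfne : ∀ j : ℕ, (√(j.factorial : ℝ) : ℂ) ≠ 0 := fun j => by
    exact_mod_cast (Real.sqrt_pos.2 (by positivity : (0 : ℝ) < (j.factorial : ℝ))).ne'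
  have hn : ∀ j : ℕ, (j.factorial : ℂ) ≠ 0 := fun j => by exact_mod_cast j.factorial_ne_zero
  induction k with
  | zero =>
    intro j
    refine ⟨fun i hi => ?_, fun h => ?_⟩
    · obtain rfl : j = 0 := by omega
      obtain rfl : i = 0 := by omega
      simp [vacuumPower]
    · rw [vacuumPower, if_neg]
      rintro rfl
      exact h 0 rfl
  | succ k ih =>
    intro j
    rcases j with _ | j
    · refine ⟨fun i hi => ?_, fun h => ?_⟩
      · obtain ⟨i, rfl⟩ : ∃ i', i = i' + 1 := ⟨i - 1, by omega⟩
        have h1 := (ih 1).1 i (by omega)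
        have hk : (((k + 1).factorial : ℕ) : ℂ) = (2 * i + 2) * k.factorial := by
          rw [Nat.factorial_succ, show k = 2 * i + 1 by omega]
          push_cast
          ring
        rw [vacuumPower_succ, zero_add, h1, hk, Nat.factorial_succ i]
        have h2 := hn i
        have h3 : (i : ℂ) + 1 ≠ 0 := by exact_mod_cast i.succ_ne_zero
        simp only [Nat.cast_zero, Real.sqrt_zero, Complex.ofReal_zero, zero_add, Nat.factorial_zero,
          Real.sqrt_one, Complex.ofReal_one, zero_mul, mul_zero, zero_sub, pow_zero, mul_one,
          one_mul, Nat.cast_one, Nat.factorial_one, div_one, pow_succ]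
        push_cast
        generalize (-(z * conj z) / 2) ^ i = w
        field_simp
      · have h1 := (ih 1).2 (fun i hi => h (i + 1) (by omega))
        simp [vacuumPower, h1]
    · refine ⟨fun i hi => ?_, fun h => ?_⟩
      · have h1 := (ih j).1 i (by omega)
        have e1 := hsq j
        have e2 := hne j
        have e3 := hfne j
        have e4 := hn i
        -- For i = 0 the level is the highest one reached after k + 1 steps, and annihilation from
        -- the level above contributes nothing.
        rcases i with _ | i
        · have h2 := (ih (j + 2)).2 (fun i hi => by omega)
          obtain rfl : k = j := by omega
          rw [vacuumPower_succ, Nat.add_sub_cancel, h1, h2, hfac k, Nat.factorial_succ k]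
          push_cast
          generalize (√((k : ℝ) + 1) : ℂ) = r at *
          generalize (√(k.factorial : ℝ) : ℂ) = f at *
          rw [← e1]
          simp only [pow_zero, Nat.factorial_zero, Nat.cast_one, pow_succ, mul_zero, sub_zero]
          field_simp
        · have h2 := (ih (j + 2)).1 i (by omega)
          have hk : (((k + 1).factorial : ℕ) : ℂ) = ((j + 1) + 2 * (i + 1)) * k.factorial := by
            rw [Nat.factorial_succ, show k = j + 2 * (i + 1) by omega]
            push_cast
            ring
          have e5 := hne (j + 1)
          have e6 := hn i
          have h5 := hfac (j + 1)
          rw [hfac j] at h5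
          have h3 : (i : ℂ) + 1 ≠ 0 := by exact_mod_cast i.succ_ne_zero
          rw [vacuumPower_succ, Nat.add_sub_cancel, h1, h2, h5, hfac j, hk, Nat.factorial_succ i,
            ← e1]
          rw [Nat.cast_succ j] at e5 ⊢
          generalize (√((j : ℝ) + 1) : ℂ) = r at *
          generalize (√((j : ℝ) + 1 + 1) : ℂ) = r' at *
          generalize (√(j.factorial : ℝ) : ℂ) = f at *
          simp only [pow_succ]
          push_cast
          generalize (-(z * conj z) / 2) ^ i = w
          field_simp
          ring
      · have h1 := (ih j).2 (fun i hi => h i (by omega))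
        have h2 := (ih (j + 2)).2 (fun i hi => h (i + 1) (by omega))
        simp only [vacuumPower, Nat.add_sub_cancel, h1, h2]
        simp

theorem vacuumPower_zero_hasSum (z : ℂ) :
    HasSum (fun k : ℕ => (k.factorial : ℂ)⁻¹ * vacuumPower z k 0)
      ((Real.exp (-(‖z‖ ^ 2 / 2)) : ℝ) : ℂ) := by
  have hinj : Function.Injective fun i : ℕ => 2 * i := fun a b h => by simpa using h
  rw [← hinj.hasSum_iff]
  · have h1 := NormedSpace.expSeries_div_hasSum_exp (-(z * conj z) / 2)
    rw [← Complex.exp_eq_exp_ℂ] at h1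
    have h2 : Complex.exp (-(z * conj z) / 2) = ((Real.exp (-(‖z‖ ^ 2 / 2)) : ℝ) : ℂ) := by
      rw [Complex.mul_conj, Complex.normSq_eq_norm_sq]
      push_cast
      congr 1
      ring
    rw [h2] at h1
    refine h1.congr_fun fun i => ?_
    have h3 := (vacuumPower_eq z (2 * i) 0).1 i (by omega)
    have h4 : ((2 * i).factorial : ℂ) ≠ 0 := by exact_mod_cast (2 * i).factorial_ne_zero
    simp only [Function.comp, h3, Nat.factorial_zero, Nat.cast_one, Real.sqrt_one,
      Complex.ofReal_one, pow_zero]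
    field_simp
  · intro k hk
    rw [(vacuumPower_eq z k 0).2 fun i hi => hk ⟨i, by simpa using hi.symm⟩, mul_zero]

/-- The number state `|n⟩` as a vector with finitely many particles. -/
def numberState (n : ℕ →₀ ℕ) : finiteParticle := ⟨lp.single 2 n 1, single_mem_finiteParticle n 1⟩

theorem norm_numberState (n : ℕ →₀ ℕ) : ‖(numberState n : Fock)‖ = 1 := by
  simp [numberState, lp.norm_single]

/-- The generator changes the occupation of mode ℓ only. As that mode is empty in |n⟩, its powers
act as on the vacuum, with the other modes as spectators. -/
theorem fieldGenerator_pow_numberState (l : ℕ) (z : ℂ) {n : ℕ →₀ ℕ} (hn : n l = 0) (k : ℕ)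
    (m : ℕ →₀ ℕ) :
    (((fieldGenerator l z) ^ k) (numberState n) : Fock) m
      = if m.erase l = n then vacuumPower z k (m l) else 0 := by
  induction k generalizing m with
  | zero =>
    rw [pow_zero, Module.End.one_apply, numberState, lp.single_apply, vacuumPower]
    have h : m = n ↔ m.erase l = n ∧ m l = 0 := by
      constructor
      · rintro rfl
        exact ⟨Finsupp.erase_of_notMem_support (by simpa using hn), hn⟩
      · rintro ⟨h1, h2⟩
        rw [← h1, Finsupp.erase_of_notMem_support (by simpa using h2)]
    by_cases h1 : m = n
    · obtain ⟨h2, h3⟩ := h.1 h1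
      rw [if_pos h2, if_pos h3]
      subst h1
      simp
    · by_cases h2 : m.erase l = n
      · rw [if_pos h2, if_neg fun h3 => h1 (h.2 ⟨h2, h3⟩)]
        simp [h1]
      · simp [h1, h2]
  | succ k ih =>
    rw [pow_succ', Module.End.mul_apply, fieldGenerator_apply', ih, ih]
    have h1 : (m - Finsupp.single l 1).erase l = m.erase l := by
      ext j
      by_cases hj : j = l
      · subst hj; simp
      · simp [Finsupp.erase_ne hj, Ne.symm hj]
    have h2 : (m + Finsupp.single l 1).erase l = m.erase l := by
      ext j
      by_cases hj : j = l
      · subst hj; simp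
      · simp [Finsupp.erase_ne hj]
    rw [h1, h2]
    by_cases h : m.erase l = n
    · simp [h, vacuumPower]
    · simp [h]

theorem weylOperator_numberState_hasSum {l : ℕ} {z : ℂ} {V : Fock ≃ₗᵢ[ℂ] Fock}
    (hV : IsWeylOperator (lp.single 2 l z) V) {n : ℕ →₀ ℕ} (hn : n l = 0) (m : ℕ →₀ ℕ) :
    HasSum (fun k : ℕ => (k.factorial : ℂ)⁻¹ *
      if m.erase l = n then vacuumPower z k (m l) else 0) (V (numberState n) m) := by
  refine (hV (numberState n) (numberState n).2 m).congr_fun fun k => ?_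
  rw [fieldOperator_iterate, Pi.smul_apply, smul_eq_mul, fieldGenerator_pow_numberState l z hn]
  have h3 : Complex.I ^ k * (-Complex.I) ^ k = 1 := by
    rw [← mul_pow, mul_neg, Complex.I_mul_I, neg_neg, one_pow]
  rw [div_mul_eq_mul_div, ← mul_assoc, h3, one_mul, div_eq_inv_mul]

theorem weylOperator_numberState_self {l : ℕ} {z : ℂ} {V : Fock ≃ₗᵢ[ℂ] Fock}
    (hV : IsWeylOperator (lp.single 2 l z) V) {n : ℕ →₀ ℕ} (hn : n l = 0) :
    V (numberState n) n = ((Real.exp (-(‖z‖ ^ 2 / 2)) : ℝ) : ℂ) := by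
  have h := weylOperator_numberState_hasSum hV hn n
  have h1 : n.erase l = n := Finsupp.erase_of_notMem_support (by simpa using hn)
  simp only [h1, if_true, hn] at h
  exact h.unique (vacuumPower_zero_hasSum z)

theorem weylOperator_numberState_of_erase_ne {l : ℕ} {z : ℂ} {V : Fock ≃ₗᵢ[ℂ] Fock}
    (hV : IsWeylOperator (lp.single 2 l z) V) {n m : ℕ →₀ ℕ} (hn : n l = 0) (hm : m.erase l ≠ n) :
    V (numberState n) m = 0 := by
  have h := weylOperator_numberState_hasSum hV hn m
  simp only [hm, if_false, mul_zero] at h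
  exact h.unique hasSum_zero

/-! ### Weyl expectations under a unitary intertwiner -/

/-- The vacuum expectation value of a Weyl operator of a vector of norm `r`. -/
def weylExpectation (r : ℝ) : ℝ := Real.exp (-(r ^ 2 / 2))

theorem norm_sum_sq_of_orthogonal {H : Type*} [NormedAddCommGroup H] [InnerProductSpace ℂ H]
    (s : Finset ℕ) (η : ℕ → H) (h : ∀ i ∈ s, ∀ j ∈ s, i ≠ j → inner ℂ (η i) (η j) = 0) :
    ‖∑ i ∈ s, η i‖ ^ 2 = ∑ i ∈ s, ‖η i‖ ^ 2 := by
  have h1 : inner ℂ (∑ i ∈ s, η i) (∑ i ∈ s, η i) = ∑ i ∈ s, inner ℂ (η i) (η i) := by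
    rw [sum_inner]
    refine Finset.sum_congr rfl fun i hi => ?_
    rw [inner_sum, Finset.sum_eq_single i]
    · intro j hj hji
      exact h i hi j hj hji.symm
    · intro hi'
      exact absurd hi hi'
  simp only [inner_self_eq_norm_sq_to_K] at h1
  exact_mod_cast h1

/-- With its expectation subtracted, a single-mode Weyl operator sends |n⟩ to states that differ
from n in exactly that mode. Different modes thus give orthogonal vectors of norm at most 2, and the
norm of the sum grows like the ℓ² norm of d rather than its ℓ¹ norm. -/
theorem norm_sum_weylOperator_sub_le {V : ℕ → Fock ≃ₗᵢ[ℂ] Fock} {z : ℕ → ℂ}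
    (hV : ∀ l, IsWeylOperator (lp.single 2 l (z l)) (V l)) {n : ℕ →₀ ℕ} {s : Finset ℕ}
    (hn : ∀ l ∈ s, n l = 0) (d : ℕ → ℝ) :
    ‖∑ l ∈ s, (d l : ℂ) • (V l (numberState n)
      - (weylExpectation ‖z l‖ : ℂ) • (numberState n : Fock))‖ ≤ 2 * √(∑ l ∈ s, d l ^ 2) := by
  set η : ℕ → Fock := fun l => V l (numberState n)
      - (weylExpectation ‖z l‖ : ℂ) • (numberState n : Fock) with hη
  have hval : ∀ l ∈ s, ∀ m, (m.erase l ≠ n ∨ m = n) → η l m = 0 := by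
    intro l hl m hm
    simp only [hη]
    rw [lp.coeFn_sub, Pi.sub_apply, lp.coeFn_smul, Pi.smul_apply]
    by_cases h : m = n
    · subst h
      rw [weylOperator_numberState_self (hV l) (hn l hl), numberState, lp.single_apply_self,
        weylExpectation]
      simp
    · rw [weylOperator_numberState_of_erase_ne (hV l) (hn l hl) (hm.resolve_right h), numberState,
        lp.single_apply_ne _ _ _ h]
      simp
  have horth : ∀ i ∈ s, ∀ j ∈ s, i ≠ j →
      inner ℂ ((d i : ℂ) • η i) ((d j : ℂ) • η j) = 0 := by
    intro i hi j hj hij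
    have h0 : inner ℂ (η i) (η j) = 0 := by
      rw [lp.inner_eq_tsum]
      convert tsum_zero with m
      by_cases h1 : m.erase i = n
      · by_cases h2 : m.erase j = n
        · have h3 : m = n := by
            ext k
            by_cases hk : k = i
            · subst hk
              rw [← h2, Finsupp.erase_ne hij]
            · rw [← h1, Finsupp.erase_ne hk]
          rw [hval i hi m (.inr h3), inner_zero_left]
        · rw [hval j hj m (.inl h2), inner_zero_right]
      · rw [hval i hi m (.inl h1), inner_zero_left]
    rw [inner_smul_left, inner_smul_right, h0, mul_zero, mul_zero]
  have hbound : ∀ l, ‖η l‖ ≤ 2 := by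
    intro l
    refine (norm_sub_le _ _).trans ?_
    rw [LinearIsometryEquiv.norm_map, norm_smul, norm_numberState, Complex.norm_real,
      weylExpectation, Real.norm_of_nonneg (Real.exp_pos _).le, mul_one]
    have : Real.exp (-(‖z l‖ ^ 2 / 2)) ≤ 1 := Real.exp_le_one_iff.2 (by
      have := sq_nonneg ‖z l‖
      linarith)
    linarith
  have h1 := norm_sum_sq_of_orthogonal s (fun l => (d l : ℂ) • η l) horth
  have h2 : ∑ l ∈ s, ‖(d l : ℂ) • η l‖ ^ 2 ≤ (2 * √(∑ l ∈ s, d l ^ 2)) ^ 2 := by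
    rw [mul_pow, Real.sq_sqrt (Finset.sum_nonneg fun l _ => sq_nonneg _), Finset.mul_sum]
    refine Finset.sum_le_sum fun l _ => ?_
    rw [norm_smul, mul_pow, Complex.norm_real, Real.norm_eq_abs, sq_abs, mul_comm]
    have := hbound l
    gcongr
  rw [← h1] at h2
  exact le_of_sq_le_sq h2 (by positivity)

/-- If a unitary operator intertwines the Weyl operators of single modes of amplitudes `a` with
those of amplitudes `b`, then their vacuum expectation values have square summable differences. -/
theorem summable_sq_of_intertwining (U : Fock ≃ₗᵢ[ℂ] Fock) {V V' : ℕ → Fock ≃ₗᵢ[ℂ] Fock}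
    {a b : ℕ → ℂ} (hV : ∀ l, IsWeylOperator (lp.single 2 l (-a l)) (V l).symm)
    (hV' : ∀ l, IsWeylOperator (lp.single 2 l (b l)) (V' l))
    (hU : ∀ l Ψ, V l (U Ψ) = U (V' l Ψ)) :
    Summable fun l => (weylExpectation ‖b l‖ - weylExpectation ‖a l‖) ^ 2 := by
  set d : ℕ → ℝ := fun l => weylExpectation ‖b l‖ - weylExpectation ‖a l‖ with hd
  set Ω : Fock := (numberState 0 : Fock)
  have hΩ : ‖U Ω‖ = 1 := by rw [LinearIsometryEquiv.norm_map, norm_numberState]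
  -- U Ω need not overlap with the vacuum, so it is tested against some number state that it does
  -- meet; the finitely many modes occupied in n are added back at the end.
  obtain ⟨n, hn⟩ : ∃ n, (U Ω) n ≠ 0 := by
    by_contra! h
    have : U Ω = 0 := by
      ext n
      rw [h n]
      rfl
    rw [this, norm_zero] at hΩ
    exact zero_ne_one hΩ
  set e : Fock := (numberState n : Fock) with he
  set c : ℂ := inner ℂ e (U Ω) with hc
  have hc0 : 0 < ‖c‖ := by
    have : c = (U Ω) n := by
      rw [hc, he, numberState, lp.inner_single_left]
      simp
    rw [this]
    exact norm_pos_iff.2 hn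
  have key : ∀ s : Finset ℕ, (∀ l ∈ s, n l = 0) → ∑ l ∈ s, d l ^ 2 ≤ 16 / ‖c‖ ^ 2 := by
    intro s hs
    set S := ∑ l ∈ s, d l ^ 2 with hS
    have hS0 : 0 ≤ S := Finset.sum_nonneg fun l _ => sq_nonneg _
    have b1 := norm_sum_weylOperator_sub_le hV hs d
    have b2 := norm_sum_weylOperator_sub_le hV' (n := 0) (s := s) (fun l _ => rfl) d
    simp only [norm_neg] at b1
    set x : Fock := ∑ l ∈ s, (d l : ℂ) • ((V l).symm (numberState n)
      - (weylExpectation ‖a l‖ : ℂ) • (numberState n : Fock)) with hx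
    set y : Fock := ∑ l ∈ s, (d l : ℂ) • (V' l (numberState 0)
      - (weylExpectation ‖b l‖ : ℂ) • (numberState 0 : Fock)) with hy
    -- The operators V(UΩ) = U(V'Ω) cancel and leave the difference d of expectations. With the
    -- weights chosen equal to d, the left side is Σd² times c while the right side is only O(√Σd²).
    have hid : (S : ℂ) * c = inner ℂ x (U Ω) - inner ℂ e (U y) := by
      rw [hx, hy, sum_inner, map_sum, inner_sum, ← Finset.sum_sub_distrib, hS, Complex.ofReal_sum,
        Finset.sum_mul]
      refine Finset.sum_congr rfl fun l _ => ?_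
      rw [inner_smul_left, map_smul, inner_smul_right, map_sub, inner_sub_left, inner_sub_right,
        map_smul, inner_smul_left, inner_smul_right, ← hU]
      have h1 : inner ℂ ((V l).symm (numberState n)) (U Ω) = inner ℂ e (V l (U Ω)) := by
        rw [← (V l).inner_map_map, LinearIsometryEquiv.apply_symm_apply]
      rw [h1, Complex.conj_ofReal, Complex.conj_ofReal]
      change _ = (d l : ℂ) * (inner ℂ e (V l (U Ω)) - (weylExpectation ‖a l‖ : ℂ) * c)
        - (d l : ℂ) * (inner ℂ e (V l (U Ω)) - (weylExpectation ‖b l‖ : ℂ) * c)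
      simp only [hd]
      push_cast
      ring
    have h2 : S * ‖c‖ ≤ 4 * √S := by
      have h3 : ‖(S : ℂ) * c‖ = S * ‖c‖ := by
        rw [norm_mul, Complex.norm_real, Real.norm_of_nonneg hS0]
      rw [← h3, hid]
      refine (norm_sub_le _ _).trans ?_
      have h4 := norm_inner_le_norm (𝕜 := ℂ) x (U Ω)
      have h5 := norm_inner_le_norm (𝕜 := ℂ) e (U y)
      rw [hΩ, mul_one] at h4
      rw [LinearIsometryEquiv.norm_map, he, norm_numberState, one_mul] at h5
      linarith
    rw [le_div_iff₀ (by positivity)]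
    have h6 : (S * ‖c‖) ^ 2 ≤ (4 * √S) ^ 2 := by gcongr
    rw [mul_pow, mul_pow, Real.sq_sqrt hS0] at h6
    rcases hS0.eq_or_lt with h | h
    · rw [← h]; norm_num
    · nlinarith
  refine summable_of_sum_le (c := 16 / ‖c‖ ^ 2 + ∑ l ∈ n.support, d l ^ 2)
    (fun l => sq_nonneg _) fun s => ?_
  calc ∑ l ∈ s, d l ^ 2 ≤ ∑ l ∈ (s \ n.support) ∪ n.support, d l ^ 2 := by
        refine Finset.sum_le_sum_of_subset_of_nonneg (fun l hl => ?_) fun l _ _ => sq_nonneg _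
        by_cases h : l ∈ n.support <;> simp_all
    _ = ∑ l ∈ s \ n.support, d l ^ 2 + ∑ l ∈ n.support, d l ^ 2 :=
        Finset.sum_union Finset.sdiff_disjoint
    _ ≤ _ := by
        gcongr
        refine key _ fun l hl => ?_
        simpa using (Finset.mem_sdiff.1 hl).2

/-! ### Unitary implementability -/

/-- The phase z = exp(-iθ/2), with θ = arg(αβ̄), aligns the two summands, so the norm is |α| + |β|;
then |α| ≥ 1 gives the bound. -/
theorem exists_phase (α β : ℂ) (h : ‖α‖ ^ 2 = 1 + ‖β‖ ^ 2) :
    ∃ z : ℂ, ‖z‖ = 1 ∧ 1 + 2 * ‖β‖ ≤ ‖α * z + β * conj z‖ ^ 2 := by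
  set θ : ℝ := (α * conj β).arg with hθ
  set z : ℂ := Complex.exp ((-(θ / 2) : ℝ) * Complex.I) with hz
  have hz1 : ‖z‖ = 1 := Complex.norm_exp_ofReal_mul_I _
  refine ⟨z, hz1, ?_⟩
  have hzz : z * conj z = 1 := by
    rw [Complex.mul_conj, Complex.normSq_eq_norm_sq, hz1]
    norm_num
  have h1 : (α * conj β) * z ^ 2 = ((‖α‖ * ‖β‖ : ℝ) : ℂ) := by
    have h2 := Complex.norm_mul_exp_arg_mul_I (α * conj β)
    rw [← hθ, norm_mul, RCLike.norm_conj] at h2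
    rw [← h2, hz, ← Complex.exp_nat_mul, mul_assoc, ← Complex.exp_add]
    have h3 : (θ * Complex.I + ((2 : ℕ) : ℂ) * ((-(θ / 2) : ℝ) * Complex.I) : ℂ) = 0 := by
      push_cast
      ring
    rw [h3, Complex.exp_zero, mul_one]
  have h4 : ((‖α * z + β * conj z‖ ^ 2 : ℝ) : ℂ)
      = ((‖α‖ ^ 2 + ‖β‖ ^ 2 + 2 * (‖α‖ * ‖β‖) : ℝ) : ℂ) := by
    have h5 : conj ((α * conj β) * z ^ 2) = ((‖α‖ * ‖β‖ : ℝ) : ℂ) := by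
      rw [h1, Complex.conj_ofReal]
    simp only [map_mul, map_pow, Complex.conj_conj] at h5
    have h6 : α * conj α = ((‖α‖ ^ 2 : ℝ) : ℂ) := by
      rw [Complex.mul_conj, Complex.normSq_eq_norm_sq]
    have h7 : β * conj β = ((‖β‖ ^ 2 : ℝ) : ℂ) := by
      rw [Complex.mul_conj, Complex.normSq_eq_norm_sq]
    rw [← Complex.normSq_eq_norm_sq, ← Complex.mul_conj]
    simp only [map_add, map_mul, Complex.conj_conj]
    rw [Complex.ofReal_add, Complex.ofReal_add, Complex.ofReal_mul 2, ← h6, ← h7]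
    push_cast at h1 h5 ⊢
    linear_combination (α * conj α + β * conj β) * hzz + h1 + h5
  have h8 := Complex.ofReal_injective h4
  have h9 : 1 ≤ ‖α‖ := by
    nlinarith [norm_nonneg α, sq_nonneg ‖β‖]
  rw [h8]
  nlinarith [norm_nonneg β, sq_nonneg ‖β‖]

theorem weylExpectation_sub_ge {r x : ℝ} (hx : 0 ≤ x) (hr : 1 + 2 * x ≤ r ^ 2) :
    weylExpectation 1 * (x / (1 + x)) ≤ weylExpectation 1 - weylExpectation r := by
  have h1 : weylExpectation r ≤ weylExpectation 1 * Real.exp (-x) := by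
    rw [weylExpectation, weylExpectation, ← Real.exp_add]
    apply Real.exp_le_exp.2
    linarith
  have h2 : Real.exp (-x) ≤ 1 / (1 + x) := by
    rw [Real.exp_neg, one_div]
    have := Real.add_one_le_exp x
    gcongr
    linarith
  have h3 : 0 < weylExpectation 1 := Real.exp_pos _
  have h4 : x / (1 + x) = 1 - 1 / (1 + x) := by
    have : 1 + x ≠ 0 := by positivity
    field_simp
    ring
  rw [h4]
  nlinarith

open Filter Topology in
-- Square summability makes the differences small eventually. This forces x ≤ 1, and there
-- `weylExpectation_sub_ge` becomes a linear bound of x by the difference.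
theorem summable_sq_of_summable_weylExpectation {r x : ℕ → ℝ} (hx : ∀ l, 0 ≤ x l)
    (hr : ∀ l, 1 + 2 * x l ≤ r l ^ 2)
    (h : Summable fun l => (weylExpectation (r l) - weylExpectation 1) ^ 2) :
    Summable fun l => x l ^ 2 := by
  have h0 : 0 < weylExpectation 1 := Real.exp_pos _
  have hev := h.tendsto_atTop_zero.eventually_le_const
    (by positivity : (0 : ℝ) < (weylExpectation 1 / 2) ^ 2)
  refine Summable.of_norm_bounded_eventually_nat (h.mul_left (2 / weylExpectation 1) |>.mul_left
    (2 / weylExpectation 1)) ?_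
  filter_upwards [hev] with l hl
  have h1 := weylExpectation_sub_ge (hx l) (hr l)
  have hxl := hx l
  set d := weylExpectation 1 - weylExpectation (r l) with hd
  have h2 : weylExpectation (r l) - weylExpectation 1 = -d := by rw [hd]; ring
  rw [h2, neg_sq] at hl ⊢
  have hd0 : 0 ≤ d := le_trans (by positivity) h1
  have h3 : d ≤ weylExpectation 1 / 2 := le_of_sq_le_sq hl (by positivity)
  have h4 : x l / (1 + x l) ≤ 1 / 2 := by
    have := h1.trans h3
    by_contra! hcon
    nlinarith
  have h5 : x l ≤ 1 := by
    rw [div_le_iff₀ (by positivity)] at h4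
    linarith
  have h6 : x l / 2 ≤ x l / (1 + x l) := by gcongr; linarith
  have h7 : x l ≤ 2 / weylExpectation 1 * d := by
    rw [div_mul_eq_mul_div, le_div_iff₀ h0]
    nlinarith
  rw [Real.norm_of_nonneg (sq_nonneg _)]
  calc x l ^ 2 ≤ (2 / weylExpectation 1 * d) ^ 2 := by gcongr
    _ = _ := by ring

/-- The necessary half of Shale's criterion for this diagonal transformation, tested on one solution
of unit one-particle norm per mode. -/
theorem summable_beta_sq_of_unitarilyImplementable (ρ ν : ℕ → ℝ) (hρ : ∀ l, 0 < ρ l) {t₀ t₁ : ℝ}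
    (ht₀ : t₀ ∈ Ioo 0 π) (ht₁ : t₁ ∈ Ioo 0 π)
    (h : UnitarilyImplementable (modeFun ρ ν) t₁ t₀) :
    Summable fun l => ‖beta (modeFun ρ ν) t₁ t₀ l‖ ^ 2 := by
  obtain ⟨U, hU⟩ := h
  choose z hz1 hz using fun l => exists_phase (alpha ρ ν t₁ t₀ l) (beta (modeFun ρ ν) t₁ t₀ l)
    (normSq_alpha ρ ν l (hρ l).ne' ht₀ ht₁)
  set w : ℕ → ℂ := fun l => alpha ρ ν t₁ t₀ l * z l + beta (modeFun ρ ν) t₁ t₀ l * conj (z l)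
  choose V hV hVs using fun l => exists_weylOperator l (z l)
  choose V' hV' _ using fun l => exists_weylOperator l (w l)
  have hint : ∀ l Ψ, V l (U Ψ) = U (V' l Ψ) := fun l Ψ => by
    rw [← hU _ _ (singleMode_isSolution ρ ν l (z l)) (singleMode_isSolution ρ ν l (w l))
      (singleMode_evolves ρ ν l (hρ l).ne' ht₀ ht₁ (z l)) _ _
      (singleMode_isOneParticleVector _ l (z l)) (singleMode_isOneParticleVector _ l (w l))
      (V l) (V' l) (hV l) (hV' l) Ψ, LinearIsometryEquiv.apply_symm_apply]
  have hsum := summable_sq_of_intertwining U hVs hV' hint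
  simp only [hz1] at hsum
  exact summable_sq_of_summable_weylExpectation (fun l => norm_nonneg _) hz hsum

end Gowdy

end

theorem mainTheorem1 (ρ ν : ℕ → ℝ) (hρ : ∀ l, 0 < ρ l) (t₀ : ℝ) (ht₀ : t₀ ∈ Set.Ioo 0 Real.pi) :
    ∀ᵐ t₁ ∂(MeasureTheory.volume.restrict (Set.Ioo 0 Real.pi)),
      ¬ Summable (fun l : ℕ => (Gowdy.beta (Gowdy.modeFun ρ ν) t₁ t₀ l).re ^ 2) ∧
      ¬ Gowdy.UnitarilyImplementable (Gowdy.modeFun ρ ν) t₁ t₀ := by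
  filter_upwards [Gowdy.ae_not_summable_beta_re ρ ν hρ ht₀,
    MeasureTheory.ae_restrict_mem measurableSet_Ioo] with t₁ h ht₁
  refine ⟨h, fun hU => h ?_⟩
  refine (Gowdy.summable_beta_sq_of_unitarilyImplementable ρ ν hρ ht₀ ht₁ hU).of_nonneg_of_le
    (fun l => sq_nonneg _) fun l => ?_
  rw [← sq_abs]
  have := Complex.abs_re_le_norm (Gowdy.beta (Gowdy.modeFun ρ ν) t₁ t₀ l)
  gcongr
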